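/- Let $N,m\ge 1$ be integers and let $\Omega\subset\mathbb R^N$ be a bounded smooth domain (all functions are real-valued). Let $C^m_\vartheta(\overline\Omega)=\{u\in C^m(\overline\Omega): \Delta^j u|_{\partial\Omega}=0 \text{ for all integers } 0\le j<\tfrac m2\}$, and for a compact set $K\subset\Omega$ let $C^m_{\vartheta,0}(\overline\Omega\setminus K)$ be the set of those $u\in C^m_\vartheta(\overline\Omega)$ which vanish in a neighbourhood of $K$. Let $V^m(\Omega)$ and $V^m_0(\Omega\setminus K)$ be either - (Dirichlet case) $V^m(\Omega)=H^m_0(\Omega)$, the closure of $C^\infty_0(\Omega)$ in $H^m(\Omega)$, and $V^m_0(\Omega\setminus K)=H^m_0(\Omega\setminus K)$, regarded as a subspace of $H^m(\Omega)$ through extension by zero, i.e. the closure of $C_0^\infty(\Omega\setminus K)$ in $H^m(\Omega)$; or - (Navier case) $V^m(\Omega)=H^m_\vartheta(\Omega)$ and $V^m_0(\Omega\setminus K)=H^m_{\vartheta,0}(\Omega\setminus K)$, the closures in $H^m(\Omega)$ of $C^m_\vartheta(\overline\Omega)$ and of $C^m_{\vartheta,0}(\overline\Omega\setminus K)$, respectively.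 Put $\nabla^m f=\Delta^{m/2}f$ if $m$ is even and $\nabla^m f=\nabla\Delta^{(m-1)/2}f$ if $m$ is odd, and define the $V^m$-capacity of $K$ in $\Omega$ by $$\mathrm{cap}_{V^m,\Omega}(K)=\inf\Big\{\int_\Omega|\nabla^m f|^2 \ :\ f\in V^m(\Omega),\ f-\eta_K\in V^m_0(\Omega\setminus K)\Big\},$$ where $\eta_K$ is any fixed smooth function with $\operatorname{supp}\eta_K\subset\Omega$ and $\eta_K\equiv 1$ in a neighbourhood of $K$. Let $x_0\in\Omega$. Then, in both the Dirichlet and the Navier case and for every such choice of $\eta_{\{x_0\}}$, $\mathrm{cap}_{V^m,\Omega}(\{x_0\})=0$ if $N\ge 2m$, while $\mathrm{cap}_{V^m,\Omega}(\{x_0\})>0$ if $N\le 2m-1$. -/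

import Mathlib

open MeasureTheory Set Filter Topology
open scoped ContDiff

noncomputable section

namespace HigherCapacity

/-- The Euclidean space `ℝ^N`. -/
abbrev Eu (N : ℕ) : Type := EuclideanSpace ℝ (Fin N)

/-! ### Bounded smooth domains -/

/-- A bounded smooth domain: nonempty, open, connected and bounded, and near every boundary point
it is the strict sublevel set of a smooth function without critical points. -/
structure IsBoundedSmoothDomain {N : ℕ} (Ω : Set (Eu N)) : Prop where
  isOpen : IsOpen Ω
  isConnected : IsConnected Ω
  isBounded : Bornology.IsBounded Ω
  smooth_boundary : ∀ p ∈ frontier Ω, ∃ (U : Set (Eu N)) (ρ : Eu N → ℝ),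
    IsOpen U ∧ p ∈ U ∧ ContDiffOn ℝ ∞ ρ U ∧ (∀ x ∈ U, fderiv ℝ ρ x ≠ 0) ∧
      Ω ∩ U = {x ∈ U | ρ x < 0}

/-! ### Classical partial derivatives and smooth function classes -/

/-- The partial derivative `∂_i u`. -/
def partialD {N : ℕ} (i : Fin N) (u : Eu N → ℝ) : Eu N → ℝ :=
  fun x => fderiv ℝ u x (EuclideanSpace.single i 1)

/-- The partial derivative `D^α u = ∂_0^{α_0} ⋯ ∂_{N-1}^{α_{N-1}} u` for a multi-index `α`. -/
def multiD {N : ℕ} (α : Fin N → ℕ) (u : Eu N → ℝ) : Eu N → ℝ :=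
  (List.finRange N).foldr (fun i v => (partialD i)^[α i] v) u

/-- The multi-indices of length `|α| ≤ m`. -/
def multiIndices (N m : ℕ) : Finset (Fin N → ℕ) :=
  (Finset.Iic (fun _ : Fin N => m)).filter fun α => ∑ i, α i ≤ m

theorem mem_multiIndices {N m : ℕ} {α : Fin N → ℕ} :
    α ∈ multiIndices N m ↔ ∑ i, α i ≤ m := by
  simp only [multiIndices, Finset.mem_filter, Finset.mem_Iic, and_iff_right_iff_imp]
  intro h i
  exact (Finset.single_le_sum (fun j _ => Nat.zero_le (α j)) (Finset.mem_univ i)).trans h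

/-- `φ ∈ C^∞_0(D)` (extended by zero outside `D`). -/
structure IsTestFunction {N : ℕ} (D : Set (Eu N)) (φ : Eu N → ℝ) : Prop where
  contDiff : ContDiff ℝ ∞ φ
  hasCompactSupport : HasCompactSupport φ
  tsupport_subset : tsupport φ ⊆ D

/-- `u ∈ C^m(closure Ω)`: `u` is `C^m` in `Ω` and its derivatives of order at most `m` extend
continuously to the closure. Only the values of `u` in `Ω` matter. -/
def IsCmUpToBoundary {N : ℕ} (m : ℕ) (Ω : Set (Eu N)) (u : Eu N → ℝ) : Prop :=
  ContDiffOn ℝ m u Ω ∧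
    ∀ α ∈ multiIndices N m, ∃ g : Eu N → ℝ, ContinuousOn g (closure Ω) ∧ EqOn (multiD α u) g Ω

/-- `u ∈ C^m_ϑ(closure Ω)`: moreover (the continuous extension of) `Δ^j u` vanishes on `∂Ω` for all
`0 ≤ j < m/2`. -/
def IsNavierCm {N : ℕ} (m : ℕ) (Ω : Set (Eu N)) (u : Eu N → ℝ) : Prop :=
  IsCmUpToBoundary m Ω u ∧
    ∀ j : ℕ, 2 * j < m → ∀ p ∈ frontier Ω,
      Tendsto ((Laplacian.laplacian (F := Eu N → ℝ))^[j] u) (𝓝[Ω] p) (𝓝 0)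

/-- The two types of boundary conditions on `∂Ω`. -/
inductive BoundaryCondition
  | dirichlet
  | navier

/-- `u ∈ X^m(Ω)`: `C^∞_0(Ω)` in the Dirichlet case, `C^m_ϑ(closure Ω)` in the Navier case. -/
def IsX {N : ℕ} (bc : BoundaryCondition) (m : ℕ) (Ω : Set (Eu N)) (u : Eu N → ℝ) : Prop :=
  match bc with
  | .dirichlet => IsTestFunction Ω u
  | .navier => IsNavierCm m Ω u

/-- `u ∈ X^m_0(Ω ∖ K)`: `C^∞_0(Ω ∖ K)` in the Dirichlet case, the functions in `C^m_ϑ(closure Ω)`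
vanishing in a neighbourhood of `K` in the Navier case. -/
def IsX₀ {N : ℕ} (bc : BoundaryCondition) (m : ℕ) (Ω K : Set (Eu N)) (u : Eu N → ℝ) : Prop :=
  match bc with
  | .dirichlet => IsTestFunction (Ω \ K) u
  | .navier => IsNavierCm m Ω u ∧ ∀ᶠ x in 𝓝ˢ K, u x = 0

/-! ### Sobolev spaces -/

/-- The real space `L²(Ω)`. -/
abbrev L2 {N : ℕ} (Ω : Set (Eu N)) : Type :=
  Lp ℝ 2 (volume.restrict Ω)

/-- `g` is the weak derivative `D^α f` in `Ω`. -/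
def IsWeakDeriv {N : ℕ} {Ω : Set (Eu N)} (α : Fin N → ℕ) (f g : L2 Ω) : Prop :=
  ∀ φ : Eu N → ℝ, IsTestFunction Ω φ →
    ∫ x in Ω, f x * multiD α φ x = (-1) ^ (∑ i, α i) * ∫ x in Ω, g x * φ x

/-- Families `(F_α)_{|α| ≤ m}` in `L²(Ω)`, with the norm `∑_{|α| ≤ m} ‖F_α‖_{L²}`. -/
abbrev Jet (N m : ℕ) (Ω : Set (Eu N)) : Type :=
  PiLp 1 (fun _ : multiIndices N m => L2 Ω)

/-- The entry of index `α` of a family (with the value `0` if `|α| > m`). -/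
def Jet.entry {N m : ℕ} {Ω : Set (Eu N)} (F : Jet N m Ω) (α : Fin N → ℕ) : L2 Ω :=
  if h : α ∈ multiIndices N m then F ⟨α, h⟩ else 0

theorem Jet.entry_add {N m : ℕ} {Ω : Set (Eu N)} (F G : Jet N m Ω) (α : Fin N → ℕ) :
    (F + G).entry α = F.entry α + G.entry α := by
  unfold Jet.entry
  split_ifs <;> simp

theorem Jet.entry_smul {N m : ℕ} {Ω : Set (Eu N)} (c : ℝ) (F : Jet N m Ω) (α : Fin N → ℕ) :
    (c • F).entry α = c • F.entry α := by
  unfold Jet.entry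
  split_ifs <;> simp

theorem Jet.entry_zero {N m : ℕ} {Ω : Set (Eu N)} (α : Fin N → ℕ) :
    (0 : Jet N m Ω).entry α = 0 := by
  unfold Jet.entry
  split_ifs <;> simp

theorem IsTestFunction.partialD {N : ℕ} {D : Set (Eu N)} {φ : Eu N → ℝ}
    (h : IsTestFunction D φ) (i : Fin N) : IsTestFunction D (partialD i φ) where
  contDiff := (h.contDiff.fderiv_right (m := ∞) (by simp)).clm_apply contDiff_const
  hasCompactSupport := h.hasCompactSupport.fderiv_apply (𝕜 := ℝ) _
  tsupport_subset := (tsupport_fderiv_apply_subset ℝ _).trans h.tsupport_subset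

theorem IsTestFunction.multiD {N : ℕ} {D : Set (Eu N)} {φ : Eu N → ℝ}
    (h : IsTestFunction D φ) (α : Fin N → ℕ) : IsTestFunction D (multiD α φ) := by
  have iter : ∀ (i : Fin N) (k : ℕ) (v : Eu N → ℝ), IsTestFunction D v →
      IsTestFunction D ((HigherCapacity.partialD i)^[k] v) := by
    intro i k
    induction k with
    | zero => exact fun v hv => hv
    | succ k ih => exact fun v hv => ih _ (hv.partialD i)
  unfold HigherCapacity.multiD
  induction List.finRange N with
  | nil => exact h
  | cons i l ih => exact iter i _ _ ih

theorem IsTestFunction.integrable_mul {N : ℕ} {Ω : Set (Eu N)} {φ : Eu N → ℝ}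
    (h : IsTestFunction Ω φ) (f : L2 Ω) :
    Integrable (fun x => f x * φ x) (volume.restrict Ω) :=
  MemLp.integrable_mul (p := 2) (q := 2) (Lp.memLp f)
    (h.contDiff.continuous.memLp_of_hasCompactSupport h.hasCompactSupport)

theorem IsWeakDeriv.add {N : ℕ} {Ω : Set (Eu N)} {α : Fin N → ℕ} {f f' g g' : L2 Ω}
    (h : IsWeakDeriv α f g) (h' : IsWeakDeriv α f' g') : IsWeakDeriv α (f + f') (g + g') := by
  intro φ hφ
  have e : ∀ (a b : L2 Ω) (ψ : Eu N → ℝ), IsTestFunction Ω ψ →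
      ∫ x in Ω, (a + b) x * ψ x = (∫ x in Ω, a x * ψ x) + ∫ x in Ω, b x * ψ x := by
    intro a b ψ hψ
    rw [← integral_add (hψ.integrable_mul a) (hψ.integrable_mul b)]
    refine integral_congr_ae ?_
    filter_upwards [Lp.coeFn_add a b] with x hx
    rw [hx, Pi.add_apply, add_mul]
  rw [e f f' _ (hφ.multiD α), e g g' _ hφ, h φ hφ, h' φ hφ, mul_add]

theorem IsWeakDeriv.smul {N : ℕ} {Ω : Set (Eu N)} {α : Fin N → ℕ} {f g : L2 Ω} (c : ℝ)
    (h : IsWeakDeriv α f g) : IsWeakDeriv α (c • f) (c • g) := by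
  intro φ hφ
  have e : ∀ (a : L2 Ω) (ψ : Eu N → ℝ),
      ∫ x in Ω, (c • a) x * ψ x = c * ∫ x in Ω, a x * ψ x := by
    intro a ψ
    rw [← integral_const_mul]
    refine integral_congr_ae ?_
    filter_upwards [Lp.coeFn_smul c a] with x hx
    rw [hx, Pi.smul_apply, smul_eq_mul, mul_assoc]
  rw [e, e, h φ hφ]
  ring

theorem isWeakDeriv_zero {N : ℕ} {Ω : Set (Eu N)} (α : Fin N → ℕ) :
    IsWeakDeriv α (0 : L2 Ω) 0 := by
  intro φ _
  have e : ∀ ψ : Eu N → ℝ, ∫ x in Ω, (0 : L2 Ω) x * ψ x = 0 := by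
    intro ψ
    refine integral_eq_zero_of_ae ?_
    filter_upwards [Lp.coeFn_zero ℝ 2 (volume.restrict Ω)] with x hx
    simp only [hx, Pi.zero_apply, zero_mul]
  rw [e, e, mul_zero]

/-- The Sobolev space `H^m(Ω)`. An element `f` is given together with all its weak derivatives of
order at most `m` (which are determined by `f`), that is, as the family `(D^α f)_{|α| ≤ m}` in
`L²(Ω)`; the norm inherited from `Jet N m Ω` is `‖f‖_{H^m} = ∑_{|α| ≤ m} ‖D^α f‖_{L²}`. -/
def Sobolev (N m : ℕ) (Ω : Set (Eu N)) : Submodule ℝ (Jet N m Ω) where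
  carrier := {F | ∀ α ∈ multiIndices N m, IsWeakDeriv α (F.entry 0) (F.entry α)}
  add_mem' := by
    intro F G hF hG α hα
    rw [Jet.entry_add, Jet.entry_add]
    exact (hF α hα).add (hG α hα)
  zero_mem' := by
    intro α _
    rw [Jet.entry_zero, Jet.entry_zero]
    exact isWeakDeriv_zero α
  smul_mem' := by
    intro c F hF α hα
    rw [Jet.entry_smul, Jet.entry_smul]
    exact (hF α hα).smul c

/-- The weak derivative `D^α f ∈ L²(Ω)` of `f ∈ H^m(Ω)`, for `|α| ≤ m`. -/
def weakD {N m : ℕ} {Ω : Set (Eu N)} (f : Sobolev N m Ω) (α : Fin N → ℕ) : L2 Ω :=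
  (f : Jet N m Ω).entry α

/-- `f ∈ H^m(Ω)` is (the class of) the function `u`, whose classical derivatives in `Ω` are the
weak derivatives of `f`. -/
def Represents {N m : ℕ} {Ω : Set (Eu N)} (u : Eu N → ℝ) (f : Sobolev N m Ω) : Prop :=
  ∀ α ∈ multiIndices N m, weakD f α =ᵐ[volume.restrict Ω] multiD α u

/-- `V^m(Ω)`, the closure of `X^m(Ω)` in `H^m(Ω)`: this is `H^m_0(Ω)` in the Dirichlet case and
`H^m_ϑ(Ω)` in the Navier case. -/
def V {N : ℕ} (bc : BoundaryCondition) (m : ℕ) (Ω : Set (Eu N)) : Set (Sobolev N m Ω) :=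
  closure {f | ∃ u, IsX bc m Ω u ∧ Represents u f}

/-- `V^m_0(Ω ∖ K)`, the closure of `X^m_0(Ω ∖ K)` in `H^m(Ω)`: this is `H^m_0(Ω ∖ K)`, whose elements
are extended by zero to `Ω`, in the Dirichlet case, and `H^m_{ϑ,0}(Ω ∖ K)` in the Navier case. -/
def V₀ {N : ℕ} (bc : BoundaryCondition) (m : ℕ) (Ω K : Set (Eu N)) : Set (Sobolev N m Ω) :=
  closure {f | ∃ u, IsX₀ bc m Ω K u ∧ Represents u f}

/-! ### The capacity -/

/-- `Δ^k D^α f ∈ L²(Ω)` for `f ∈ H^m(Ω)` and `2k + |α| ≤ m`. -/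
def lapPow {N m : ℕ} {Ω : Set (Eu N)} (f : Sobolev N m Ω) : ℕ → (Fin N → ℕ) → L2 Ω
  | 0, α => weakD f α
  | k + 1, α => ∑ i, lapPow f k (α + Pi.single i 2)

/-- `|∇^m f|²`, where `∇^m f = Δ^{m/2} f` if `m` is even and `∇^m f = ∇ Δ^{(m-1)/2} f` if `m` is
odd. -/
def gradSq {N m : ℕ} {Ω : Set (Eu N)} (f : Sobolev N m Ω) (x : Eu N) : ℝ :=
  if Even m then (lapPow f (m / 2) 0 x) ^ 2
  else ∑ i, (lapPow f (m / 2) (Pi.single i 1) x) ^ 2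

/-- An admissible cut-off `η_K`: smooth, (compactly) supported in `Ω`, and equal to `1` in a
neighbourhood of `K`. -/
def IsCutoff {N : ℕ} (Ω K : Set (Eu N)) (η : Eu N → ℝ) : Prop :=
  IsTestFunction Ω η ∧ ∀ᶠ x in 𝓝ˢ K, η x = 1

/-- The `V^m`-capacity of the compact set `K` in `Ω`, formed with the cut-off `η`: the infimum of
`∫_Ω |∇^m f|²` over all `f ∈ V^m(Ω)` with `f - η ∈ V^m_0(Ω ∖ K)`. -/
def capV {N : ℕ} (bc : BoundaryCondition) (m : ℕ) (Ω K : Set (Eu N)) (η : Eu N → ℝ) : ℝ :=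
  sInf {c | ∃ f h : Sobolev N m Ω, f ∈ V bc m Ω ∧ Represents η h ∧ f - h ∈ V₀ bc m Ω K ∧
    c = ∫ x in Ω, gradSq f x}

end HigherCapacity

end

noncomputable section

namespace HigherCapacity

variable {N m : ℕ} {Ω : Set (Eu N)}

/-! ### Calculus of partial derivatives on an open set -/

/-! Under `x ↦ c (x - x₀)` the energy scales like `c ^ (2m - N)`, and this exponent decides between
the two cases.

If `N ≥ 2m`, concentrating a bump at `x₀` does not increase its energy. Take bumps equal to `1` near
`x₀` at the scales `r / 4^k`. The shells on which they are not constant are disjoint, so the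
energies of a sum add up without cross terms (`gradSqFun_sum_const_mul`). The mean of `n + 1` such
bumps is still `1` near `x₀` and has energy at most `E / (n + 1)`. This covers the critical case `N
= 2m` without logarithmic cut-offs (`capV_singleton_eq_zero`).

If `N ≤ 2m - 1`, the local means of `f` at `x₀` are bounded by `‖f‖²` plus the energy, uniformly in
the radius; this is a substitute for the Sobolev embedding into continuous functions. It rests on
compactly supported kernels that imitate the Gaussian identity `∂_t G = t Δ G` for `G = t^{-N}
exp(-|x|²/(2t²))`. With profiles satisfying `S_{j+1}' = -S_j / 2`, the functions `K_j = Δ^j (t^{-N}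
S_j(|x - x₀|²/t²))` satisfy `∂_t K_j = t K_{j+1}` (`hasDerivAt_kernel`), because the Laplacian and
the Euler operator have a simple commutator (`radialLapl_euler`). Hence the integrals `A_j(t)` of
`f` against `K_j` satisfy `A_j' = t A_{j+1}`. For `J = ⌈m/2⌉`, integration by parts and
Cauchy-Schwarz bound `A_J` by the energy with a singularity of order at most `t^{-2J + 1/2}`
(`exists_average_sq_le`). Integrating `J` times from `t = 1` downwards yields a bounded `A_0`
(`abs_le_of_hasDerivAt_chain`, `exists_average_zero_sq_le`).

For an admissible `f`, the means of `f - η` tend to `0`, because `f - η` is a limit of functions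
vanishing near `x₀` and the bound is uniform in the radius; the means of `η` are eventually a fixed
positive constant. So `‖f‖²` plus the energy is bounded below. Finally `‖f‖²` is absorbed into the
energy by Poincaré inequalities applied to `u, Δu, Δ²u, …`, each of which vanishes on the boundary
(`exists_norm_sq_le_integral_gradSq`). These are proved by truncating at height `ε`, which gives
compact support inside the domain. -/

theorem partialD_eqOn {D : Set (Eu N)} (hD : IsOpen D) {u v : Eu N → ℝ} (h : EqOn u v D)
    (i : Fin N) : EqOn (partialD i u) (partialD i v) D := by
  intro x hx
  have : u =ᶠ[𝓝 x] v := h.eventuallyEq_of_mem (hD.mem_nhds hx)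
  simp only [partialD, this.fderiv_eq]

theorem partialD_iterate_eqOn {D : Set (Eu N)} (hD : IsOpen D) {u v : Eu N → ℝ} (h : EqOn u v D)
    (i : Fin N) (k : ℕ) : EqOn ((partialD i)^[k] u) ((partialD i)^[k] v) D := by
  induction k generalizing u v with
  | zero => exact h
  | succ k ih => exact ih (partialD_eqOn hD h i)

theorem contDiffOn_partialD {D : Set (Eu N)} (hD : IsOpen D) {u : Eu N → ℝ} {n : ℕ}
    (h : ContDiffOn ℝ (n + 1 : ℕ) u D) (i : Fin N) : ContDiffOn ℝ n (partialD i u) D :=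
  (h.fderiv_of_isOpen hD (m := n) (by norm_cast)).clm_apply contDiffOn_const

theorem contDiffOn_partialD_iterate {D : Set (Eu N)} (hD : IsOpen D) {u : Eu N → ℝ} {n k : ℕ}
    (h : ContDiffOn ℝ (n + k : ℕ) u D) (i : Fin N) : ContDiffOn ℝ n ((partialD i)^[k] u) D := by
  induction k generalizing u with
  | zero => exact h
  | succ k ih => exact ih (contDiffOn_partialD hD h i)

theorem contDiff_partialD {u : Eu N → ℝ} (h : ContDiff ℝ ∞ u) (i : Fin N) :
    ContDiff ℝ ∞ (partialD i u) :=
  (h.fderiv_right (m := ∞) (by simp)).clm_apply contDiff_const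

theorem differentiableAt_of_contDiffOn {D : Set (Eu N)} (hD : IsOpen D) {u : Eu N → ℝ} {n : ℕ}
    (h : ContDiffOn ℝ (n + 1 : ℕ) u D) {x : Eu N} (hx : x ∈ D) : DifferentiableAt ℝ u x :=
  (h.contDiffAt (hD.mem_nhds hx)).differentiableAt (by simp)

theorem partialD_comm_eqOn {D : Set (Eu N)} (hD : IsOpen D) {u : Eu N → ℝ}
    (h : ContDiffOn ℝ (2 : ℕ) u D) (i j : Fin N) :
    EqOn (partialD i (partialD j u)) (partialD j (partialD i u)) D := by
  intro x hx
  have h2 : ContDiffAt ℝ 2 u x := h.contDiffAt (hD.mem_nhds hx)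
  have hd : DifferentiableAt ℝ (fderiv ℝ u) x :=
    (h2.fderiv_right (m := 1) (by norm_num)).differentiableAt (by simp)
  have e : ∀ k l : Fin N, partialD k (partialD l u) x =
      fderiv ℝ (fderiv ℝ u) x (EuclideanSpace.single k 1) (EuclideanSpace.single l 1) := by
    intro k l
    change fderiv ℝ (fun y => fderiv ℝ u y (EuclideanSpace.single l 1)) x _ = _
    rw [fderiv_clm_apply hd (differentiableAt_const _)]
    simp
  rw [e, e]
  exact h2.isSymmSndFDerivAt (by simp) _ _

theorem partialD_iterate_comm_eqOn {D : Set (Eu N)} (hD : IsOpen D) {u : Eu N → ℝ} {k : ℕ}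
    (h : ContDiffOn ℝ (k + 1 : ℕ) u D) (i j : Fin N) :
    EqOn ((partialD j)^[k] (partialD i u)) (partialD i ((partialD j)^[k] u)) D := by
  induction k generalizing u with
  | zero => exact fun x _ => rfl
  | succ k ih =>
    have h1 : EqOn ((partialD j)^[k] (partialD j (partialD i u)))
        ((partialD j)^[k] (partialD i (partialD j u))) D :=
      partialD_iterate_eqOn hD (partialD_comm_eqOn hD (h.of_le (by norm_cast; omega)) j i) j k
    exact h1.trans (ih (contDiffOn_partialD hD h j))

theorem partialD_sum_eqOn {D : Set (Eu N)} (hD : IsOpen D) {ι : Type*} (s : Finset ι)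
    {u : ι → Eu N → ℝ} (hu : ∀ k ∈ s, ContDiffOn ℝ (1 : ℕ) (u k) D) (i : Fin N) :
    EqOn (partialD i (fun x => ∑ k ∈ s, u k x)) (fun x => ∑ k ∈ s, partialD i (u k) x) D := by
  intro x hx
  simp only [partialD]
  rw [fderiv_fun_sum (fun k hk => differentiableAt_of_contDiffOn hD (hu k hk) hx)]
  simp

/-- No differentiability is needed: a nonzero factor preserves differentiability and its failure,
and for `c = 0` both sides vanish. -/
theorem partialD_const_mul {u : Eu N → ℝ} (c : ℝ) (i : Fin N) :
    partialD i (fun x => c * u x) = fun x => c * partialD i u x := by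
  funext x
  simp only [partialD]
  have : (fun x => c * u x) = c • u := rfl
  rw [this, fderiv_const_smul_field]
  simp

theorem partialD_mul {u v : Eu N → ℝ} {x : Eu N} (hu : DifferentiableAt ℝ u x)
    (hv : DifferentiableAt ℝ v x) (i : Fin N) :
    partialD i (fun y => u y * v y) x = u x * partialD i v x + partialD i u x * v x := by
  simp only [partialD]
  rw [fderiv_fun_mul hu hv]
  simp [mul_comm]

theorem partialD_eq_zero_of_eventually_const {u : Eu N → ℝ} {c : ℝ} {x : Eu N}
    (h : ∀ᶠ y in 𝓝 x, u y = c) (i : Fin N) : ∀ᶠ y in 𝓝 x, partialD i u y = 0 := by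
  filter_upwards [h.eventually_nhds] with y hy
  have : u =ᶠ[𝓝 y] fun _ => c := hy
  simp [partialD, this.fderiv_eq]

/-! ### Iterated partial derivatives along a list of directions -/

/-- The derivative `∏_{i ∈ l} ∂_i^{α_i}`, in the order given by the list `l`. -/
def listD (l : List (Fin N)) (α : Fin N → ℕ) (u : Eu N → ℝ) : Eu N → ℝ :=
  l.foldr (fun i v => (partialD i)^[α i] v) u

theorem multiD_eq_listD (α : Fin N → ℕ) (u : Eu N → ℝ) :
    multiD α u = listD (List.finRange N) α u := rfl

theorem listD_cons (i : Fin N) (l : List (Fin N)) (α : Fin N → ℕ) (u : Eu N → ℝ) :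
    listD (i :: l) α u = (partialD i)^[α i] (listD l α u) := rfl

theorem contDiffOn_listD {D : Set (Eu N)} (hD : IsOpen D) {u : Eu N → ℝ} (α : Fin N → ℕ)
    (l : List (Fin N)) {n : ℕ} (h : ContDiffOn ℝ (n + (l.map α).sum : ℕ) u D) :
    ContDiffOn ℝ n (listD l α u) D := by
  induction l generalizing n with
  | nil => exact h
  | cons i l ih =>
    rw [listD_cons]
    refine contDiffOn_partialD_iterate hD (ih (h.of_le ?_)) i
    simp only [List.map_cons, List.sum_cons]
    norm_cast
    omega

theorem listD_add_single_of_notMem {i : Fin N} {l : List (Fin N)} (hi : i ∉ l) (α : Fin N → ℕ)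
    (u : Eu N → ℝ) : listD l (α + Pi.single i 1) u = listD l α u := by
  induction l with
  | nil => rfl
  | cons j l ih =>
    have hj : j ≠ i := fun h => hi (h ▸ List.mem_cons_self)
    rw [listD_cons, listD_cons, ih (fun h => hi (List.mem_cons_of_mem _ h))]
    simp [hj]

/-- The additional `∂_i` arises at the slot of `i` in the list and is commuted outwards past the
directions before it. `Nodup` matters because every occurrence of `i` would contribute another
derivative. -/
theorem listD_add_single_eqOn {D : Set (Eu N)} (hD : IsOpen D) {u : Eu N → ℝ} (α : Fin N → ℕ)
    {l : List (Fin N)} (hl : l.Nodup) {i : Fin N} (hi : i ∈ l)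
    (h : ContDiffOn ℝ ((l.map α).sum + 1 : ℕ) u D) :
    EqOn (listD l (α + Pi.single i 1) u) (partialD i (listD l α u)) D := by
  induction l with
  | nil => simp at hi
  | cons j l ih =>
    rw [listD_cons, listD_cons]
    simp only [List.map_cons, List.sum_cons] at h
    by_cases hj : j = i
    · subst hj
      rw [listD_add_single_of_notMem (List.nodup_cons.1 hl).1]
      simp only [Pi.add_apply, Pi.single_eq_same, Function.iterate_succ_apply']
      exact fun x _ => rfl
    · have hil : i ∈ l := (List.mem_cons.1 hi).resolve_left (Ne.symm hj)
      have h1 := ih (List.nodup_cons.1 hl).2 hil (h.of_le (by norm_cast; omega))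
      have e : (α + Pi.single i 1 : Fin N → ℕ) j = α j := by simp [hj]
      rw [e]
      refine (partialD_iterate_eqOn hD h1 j (α j)).trans
        (partialD_iterate_comm_eqOn hD (contDiffOn_listD hD α l (h.of_le ?_)) i j)
      norm_cast
      omega

theorem sum_map_finRange (α : Fin N → ℕ) : ((List.finRange N).map α).sum = ∑ i, α i := by
  rw [← List.ofFn_eq_map, List.sum_ofFn]

theorem multiD_zero (u : Eu N → ℝ) : multiD 0 u = u := by
  rw [multiD_eq_listD]
  induction List.finRange N with
  | nil => rfl
  | cons i l ih => rw [listD_cons, ih]; rfl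

/-- `D^{α + e_i} u = ∂_i D^α u`. -/
theorem multiD_add_single_eqOn {D : Set (Eu N)} (hD : IsOpen D) {u : Eu N → ℝ} (α : Fin N → ℕ)
    (i : Fin N) (h : ContDiffOn ℝ (∑ i, α i + 1 : ℕ) u D) :
    EqOn (multiD (α + Pi.single i 1) u) (partialD i (multiD α u)) D :=
  listD_add_single_eqOn hD α (List.nodup_finRange N) (List.mem_finRange i)
    (by rwa [sum_map_finRange])

theorem multiD_single_eqOn {D : Set (Eu N)} (hD : IsOpen D) {u : Eu N → ℝ}
    (i : Fin N) (h : ContDiffOn ℝ (1 : ℕ) u D) :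
    EqOn (multiD (Pi.single i 1) u) (partialD i u) D := by
  have := multiD_add_single_eqOn hD (0 : Fin N → ℕ) i (u := u) (by simpa using h)
  rwa [zero_add, multiD_zero] at this

theorem listD_partialD_comm_eqOn {D : Set (Eu N)} (hD : IsOpen D) {u : Eu N → ℝ} (α : Fin N → ℕ)
    (l : List (Fin N)) (i : Fin N) (h : ContDiffOn ℝ ((l.map α).sum + 1 : ℕ) u D) :
    EqOn (listD l α (partialD i u)) (partialD i (listD l α u)) D := by
  induction l with
  | nil => exact fun x _ => rfl
  | cons j l ih =>
    simp only [List.map_cons, List.sum_cons] at h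
    rw [listD_cons, listD_cons]
    refine (partialD_iterate_eqOn hD (ih (h.of_le (by norm_cast; omega))) j (α j)).trans
      (partialD_iterate_comm_eqOn hD (contDiffOn_listD hD α l (h.of_le ?_)) i j)
    norm_cast
    omega

theorem multiD_partialD_comm_eqOn {D : Set (Eu N)} (hD : IsOpen D) {u : Eu N → ℝ} (α : Fin N → ℕ)
    (i : Fin N) (h : ContDiffOn ℝ (∑ i, α i + 1 : ℕ) u D) :
    EqOn (multiD α (partialD i u)) (partialD i (multiD α u)) D :=
  listD_partialD_comm_eqOn hD α _ i (by rwa [sum_map_finRange])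

theorem listD_sum_eqOn {D : Set (Eu N)} (hD : IsOpen D) {ι : Type*} (s : Finset ι)
    {u : ι → Eu N → ℝ} (α : Fin N → ℕ) (l : List (Fin N))
    (hu : ∀ k ∈ s, ContDiffOn ℝ ((l.map α).sum : ℕ) (u k) D) :
    EqOn (listD l α (fun x => ∑ k ∈ s, u k x)) (fun x => ∑ k ∈ s, listD l α (u k) x) D := by
  have iter : ∀ (i : Fin N) (n : ℕ) (v : ι → Eu N → ℝ), (∀ k ∈ s, ContDiffOn ℝ n (v k) D) →
      EqOn ((partialD i)^[n] (fun x => ∑ k ∈ s, v k x))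
        (fun x => ∑ k ∈ s, (partialD i)^[n] (v k) x) D := by
    intro i n
    induction n with
    | zero => exact fun v _ x _ => rfl
    | succ n ih =>
      intro v hv
      refine (partialD_iterate_eqOn hD (partialD_sum_eqOn hD s
        (fun k hk => (hv k hk).of_le (by norm_cast; omega)) i) i n).trans ?_
      exact ih (fun k => partialD i (v k)) fun k hk => contDiffOn_partialD hD (hv k hk) i
  induction l with
  | nil => exact fun x _ => rfl
  | cons j l ih =>
    simp only [List.map_cons, List.sum_cons] at hu
    rw [listD_cons]
    refine (partialD_iterate_eqOn hD (ih fun k hk => (hu k hk).of_le (by norm_cast; omega))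
      j (α j)).trans ?_
    exact iter j (α j) _ fun k hk => contDiffOn_listD hD α l (hu k hk)

theorem multiD_sum_eqOn {D : Set (Eu N)} (hD : IsOpen D) {ι : Type*} (s : Finset ι)
    {u : ι → Eu N → ℝ} (α : Fin N → ℕ) (hu : ∀ k ∈ s, ContDiffOn ℝ (∑ i, α i : ℕ) (u k) D) :
    EqOn (multiD α (fun x => ∑ k ∈ s, u k x)) (fun x => ∑ k ∈ s, multiD α (u k) x) D :=
  listD_sum_eqOn hD s α _ (by rwa [sum_map_finRange])

/-! ### The Laplacian in coordinates -/

/-- The Laplacian as the sum of the second partial derivatives. -/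
def lapl (u : Eu N → ℝ) : Eu N → ℝ := fun x => ∑ i, partialD i (partialD i u) x

theorem contDiffOn_lapl {D : Set (Eu N)} (hD : IsOpen D) {u : Eu N → ℝ} {n : ℕ}
    (h : ContDiffOn ℝ (n + 2 : ℕ) u D) : ContDiffOn ℝ n (lapl u) D :=
  ContDiffOn.sum fun i _ => contDiffOn_partialD hD (contDiffOn_partialD hD h i) i

theorem contDiffOn_lapl_iterate {D : Set (Eu N)} (hD : IsOpen D) {u : Eu N → ℝ} {n k : ℕ}
    (h : ContDiffOn ℝ (n + 2 * k : ℕ) u D) : ContDiffOn ℝ n (lapl^[k] u) D := by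
  induction k generalizing u with
  | zero => exact h
  | succ k ih => exact ih (contDiffOn_lapl hD (h.of_le (by norm_cast)))

theorem contDiff_lapl {u : Eu N → ℝ} (h : ContDiff ℝ ∞ u) : ContDiff ℝ ∞ (lapl u) :=
  ContDiff.sum fun i _ => contDiff_partialD (contDiff_partialD h i) i

theorem contDiff_lapl_iterate {u : Eu N → ℝ} (h : ContDiff ℝ ∞ u) (k : ℕ) :
    ContDiff ℝ ∞ (lapl^[k] u) := by
  induction k generalizing u with
  | zero => exact h
  | succ k ih => exact ih (contDiff_lapl h)

theorem laplacian_eqOn_lapl {D : Set (Eu N)} (hD : IsOpen D) {u : Eu N → ℝ}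
    (h : ContDiffOn ℝ (2 : ℕ) u D) :
    EqOn (Laplacian.laplacian (F := Eu N → ℝ) u) (lapl u) D := by
  intro x hx
  have h2 : ContDiffAt ℝ 2 u x := h.contDiffAt (hD.mem_nhds hx)
  have hd : DifferentiableAt ℝ (fderiv ℝ u) x :=
    (h2.fderiv_right (m := 1) (by norm_num)).differentiableAt (by simp)
  rw [InnerProductSpace.laplacian_eq_iteratedFDeriv_orthonormalBasis u
    (EuclideanSpace.basisFun (Fin N) ℝ)]
  refine Finset.sum_congr rfl fun i _ => ?_
  rw [iteratedFDeriv_two_apply]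
  change _ = fderiv ℝ (fun y => fderiv ℝ u y (EuclideanSpace.single i 1)) x _
  rw [fderiv_clm_apply hd (differentiableAt_const _)]
  simp

theorem laplacian_iterate_eqOn_lapl {D : Set (Eu N)} (hD : IsOpen D) {u : Eu N → ℝ} {k : ℕ}
    (h : ContDiffOn ℝ (2 * k : ℕ) u D) :
    EqOn ((Laplacian.laplacian (F := Eu N → ℝ))^[k] u) (lapl^[k] u) D := by
  induction k with
  | zero => exact fun x _ => rfl
  | succ k ih =>
    rw [Function.iterate_succ_apply', Function.iterate_succ_apply']
    intro x hx
    have h1 := ih (h.of_le (by norm_cast; omega))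
    have h2 := (InnerProductSpace.laplacian_congr_nhds
      (h1.eventuallyEq_of_mem (hD.mem_nhds hx))).eq_of_nhds
    rw [h2]
    exact laplacian_eqOn_lapl hD
      (contDiffOn_lapl_iterate hD (h.of_le (by norm_cast; omega))) hx

/-- `∑_i D^{α + 2 e_i} u = D^α Δ u`. -/
theorem sum_multiD_add_two_eqOn {D : Set (Eu N)} (hD : IsOpen D) {u : Eu N → ℝ} (α : Fin N → ℕ)
    (h : ContDiffOn ℝ (∑ i, α i + 2 : ℕ) u D) :
    EqOn (fun x => ∑ i, multiD (α + Pi.single i 2) u x) (multiD α (lapl u)) D := by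
  have key : ∀ i, EqOn (multiD (α + Pi.single i 2) u) (multiD α (partialD i (partialD i u))) D := by
    intro i
    have e : α + Pi.single i 2 = (α + Pi.single i 1) + Pi.single i 1 := by
      rw [add_assoc, ← Pi.single_add]
    have hs : ∑ j, (α + Pi.single i 1 : Fin N → ℕ) j = ∑ j, α j + 1 := by
      simp [Finset.sum_add_distrib]
    rw [e]
    refine (multiD_add_single_eqOn hD _ i (by rw [hs]; exact h)).trans ?_
    refine (partialD_eqOn hD ((multiD_add_single_eqOn hD α i
      (h.of_le (by norm_cast; omega))).trans (multiD_partialD_comm_eqOn hD α i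
      (h.of_le (by norm_cast; omega))).symm) i).trans ?_
    exact (multiD_partialD_comm_eqOn hD α i
      (contDiffOn_partialD hD (h.of_le (by norm_cast)) i)).symm
  intro x hx
  refine (Finset.sum_congr rfl fun i _ => key i hx).trans ?_
  exact (multiD_sum_eqOn hD Finset.univ α (fun i _ =>
    contDiffOn_partialD hD (contDiffOn_partialD hD h i) i) hx).symm

/-! ### The operators `Δ^k D^α` on the Sobolev space -/

/-- `weakD` as a continuous linear map. -/
def weakDL (N m : ℕ) (Ω : Set (Eu N)) (α : Fin N → ℕ) : Sobolev N m Ω →L[ℝ] L2 Ω :=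
  if h : α ∈ multiIndices N m then
    (PiLp.proj 1 (fun _ : multiIndices N m => L2 Ω) ⟨α, h⟩ : Jet N m Ω →L[ℝ] L2 Ω).comp
      (Sobolev N m Ω).subtypeL
  else 0

theorem weakDL_apply (f : Sobolev N m Ω) (α : Fin N → ℕ) : weakDL N m Ω α f = weakD f α := by
  unfold weakDL weakD Jet.entry
  split_ifs <;> rfl

/-- `lapPow` as a continuous linear map. -/
def lapPowL (N m : ℕ) (Ω : Set (Eu N)) : ℕ → (Fin N → ℕ) → (Sobolev N m Ω →L[ℝ] L2 Ω)
  | 0, α => weakDL N m Ω α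
  | k + 1, α => ∑ i, lapPowL N m Ω k (α + Pi.single i 2)

theorem lapPowL_apply (f : Sobolev N m Ω) (k : ℕ) (α : Fin N → ℕ) :
    lapPowL N m Ω k α f = lapPow f k α := by
  induction k generalizing α with
  | zero => exact weakDL_apply f α
  | succ k ih => simp [lapPowL, lapPow, ih]

theorem sum_add_single_two (α : Fin N → ℕ) (i : Fin N) :
    ∑ j, (α + Pi.single i 2 : Fin N → ℕ) j = ∑ j, α j + 2 := by
  simp [Finset.sum_add_distrib]

theorem coeFn_finset_sum {ι : Type*} (s : Finset ι) (g : ι → L2 Ω) :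
    (∑ i ∈ s, g i : L2 Ω) =ᵐ[volume.restrict Ω] fun x => ∑ i ∈ s, g i x := by
  classical
  induction s using Finset.induction_on with
  | empty =>
    filter_upwards [Lp.coeFn_zero ℝ 2 (volume.restrict Ω)] with x hx
    simpa using hx
  | insert a s ha ih =>
    rw [Finset.sum_insert ha]
    filter_upwards [Lp.coeFn_add (g a) (∑ i ∈ s, g i), ih] with x h1 h2
    rw [h1, Pi.add_apply, h2, Finset.sum_insert ha]

/-- For `f` represented by `u`, the class `Δ^k D^α f` is represented by `D^α Δ^k u`. -/
theorem lapPow_ae_eq (hΩ : IsOpen Ω) {u : Eu N → ℝ} (hu : ContDiffOn ℝ m u Ω)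
    {f : Sobolev N m Ω} (hf : Represents u f) (k : ℕ) (α : Fin N → ℕ)
    (hk : 2 * k + ∑ i, α i ≤ m) :
    lapPow f k α =ᵐ[volume.restrict Ω] multiD α (lapl^[k] u) := by
  induction k generalizing α with
  | zero => exact hf α (mem_multiIndices.2 (by simpa using hk))
  | succ k ih =>
    have h1 : ∀ᵐ x ∂volume.restrict Ω, ∀ i, lapPow f k (α + Pi.single i 2) x =
        multiD (α + Pi.single i 2) (lapl^[k] u) x :=
      ae_all_iff.2 fun i => ih _ (by rw [sum_add_single_two]; omega)
    filter_upwards [coeFn_finset_sum Finset.univ fun i => lapPow f k (α + Pi.single i 2), h1,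
      ae_restrict_mem hΩ.measurableSet] with x h2 h3 hx
    rw [lapPow, h2, Function.iterate_succ_apply']
    refine (Finset.sum_congr rfl fun i _ => h3 i).trans ?_
    exact sum_multiD_add_two_eqOn hΩ α
      (contDiffOn_lapl_iterate hΩ (hu.of_le (by norm_cast; omega))) hx

theorem IsTestFunction.contDiffOn {D : Set (Eu N)} {φ : Eu N → ℝ} (h : IsTestFunction D φ) (n : ℕ)
    (E : Set (Eu N)) : ContDiffOn ℝ n φ E :=
  (h.contDiff.of_le (by exact_mod_cast le_top)).contDiffOn

theorem isTestFunction_sum {D : Set (Eu N)} {ι : Type*} (s : Finset ι) {φ : ι → Eu N → ℝ}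
    (h : ∀ i ∈ s, IsTestFunction D (φ i)) : IsTestFunction D (fun x => ∑ i ∈ s, φ i x) := by
  classical
  induction s using Finset.induction_on with
  | empty =>
    have e : (fun x : Eu N => ∑ i ∈ (∅ : Finset ι), φ i x) = 0 := by
      funext x
      simp
    rw [e]
    exact ⟨contDiff_const, HasCompactSupport.zero, by simp [tsupport]⟩
  | insert a s ha ih =>
    have h1 := ih fun i hi => h i (Finset.mem_insert_of_mem hi)
    have h2 := h a (Finset.mem_insert_self _ _)
    have e : (fun x => ∑ i ∈ insert a s, φ i x) = φ a + fun x => ∑ i ∈ s, φ i x := by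
      funext x
      simp [Finset.sum_insert ha]
    rw [e]
    exact ⟨h2.contDiff.add h1.contDiff, h2.hasCompactSupport.add h1.hasCompactSupport,
      (tsupport_add _ _).trans (union_subset h2.tsupport_subset h1.tsupport_subset)⟩

theorem IsTestFunction.const_mul {D : Set (Eu N)} {φ : Eu N → ℝ} (h : IsTestFunction D φ) (c : ℝ) :
    IsTestFunction D (fun x => c * φ x) :=
  ⟨contDiff_const.mul h.contDiff, h.hasCompactSupport.mul_left,
    (tsupport_mul_subset_right (f := fun _ => c) (g := φ)).trans h.tsupport_subset⟩

theorem IsTestFunction.lapl {D : Set (Eu N)} {φ : Eu N → ℝ} (h : IsTestFunction D φ) :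
    IsTestFunction D (lapl φ) :=
  isTestFunction_sum _ fun i _ => (h.partialD i).partialD i

theorem IsTestFunction.lapl_iterate {D : Set (Eu N)} {φ : Eu N → ℝ} (h : IsTestFunction D φ)
    (k : ℕ) : IsTestFunction D (HigherCapacity.lapl^[k] φ) := by
  induction k generalizing φ with
  | zero => exact h
  | succ k ih => exact ih h.lapl

theorem IsTestFunction.eq_zero {D : Set (Eu N)} {φ : Eu N → ℝ} (h : IsTestFunction D φ)
    {x : Eu N} (hx : x ∉ D) : φ x = 0 :=
  image_eq_zero_of_notMem_tsupport fun hx' => hx (h.tsupport_subset hx')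

theorem IsTestFunction.memLp {D : Set (Eu N)} {φ : Eu N → ℝ} (h : IsTestFunction D φ)
    (μ : Measure (Eu N)) [IsFiniteMeasureOnCompacts μ] : MemLp φ 2 μ :=
  h.contDiff.continuous.memLp_of_hasCompactSupport h.hasCompactSupport

/-- The weak form of `Δ^k D^α f`. -/
theorem integral_lapPow_mul (f : Sobolev N m Ω) {φ : Eu N → ℝ}
    (hφ : IsTestFunction Ω φ) (k : ℕ) (α : Fin N → ℕ) (hk : 2 * k + ∑ i, α i ≤ m) :
    ∫ x in Ω, lapPow f k α x * φ x =
      (-1) ^ (∑ i, α i) * ∫ x in Ω, weakD f 0 x * multiD α (lapl^[k] φ) x := by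
  induction k generalizing α with
  | zero =>
    have h := f.2 α (mem_multiIndices.2 (by simpa using hk)) φ hφ
    have h' : ∫ x in Ω, weakD f 0 x * multiD α φ x =
      (-1) ^ (∑ i, α i) * ∫ x in Ω, lapPow f 0 α x * φ x := h
    rw [Function.iterate_zero, id, h', ← mul_assoc, ← mul_pow]
    simp
  | succ k ih =>
    have e1 : ∫ x in Ω, lapPow f (k + 1) α x * φ x =
        ∑ i, ∫ x in Ω, lapPow f k (α + Pi.single i 2) x * φ x := by
      rw [← integral_finsetSum _ fun i _ => hφ.integrable_mul _]
      refine integral_congr_ae ?_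
      filter_upwards [coeFn_finset_sum Finset.univ fun i => lapPow f k (α + Pi.single i 2)]
        with x hx
      rw [lapPow, hx, Finset.sum_mul]
    have e2 : ∫ x in Ω, weakD f 0 x * multiD α (lapl^[k + 1] φ) x =
        ∑ i, ∫ x in Ω, weakD f 0 x * multiD (α + Pi.single i 2) (lapl^[k] φ) x := by
      rw [← integral_finsetSum _ fun i _ => ((hφ.lapl_iterate k).multiD _).integrable_mul _]
      refine integral_congr_ae (Eventually.of_forall fun x => ?_)
      simp only
      rw [← Finset.mul_sum, Function.iterate_succ_apply']
      congr 1
      exact (sum_multiD_add_two_eqOn isOpen_univ α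
        ((hφ.lapl_iterate k).contDiffOn _ _) (mem_univ x)).symm
    rw [e1, e2, Finset.mul_sum]
    refine Finset.sum_congr rfl fun i _ => ?_
    rw [ih _ (by rw [sum_add_single_two]; omega), sum_add_single_two, pow_add]
    simp

/-! ### The energy -/

theorem integral_sq_eq_norm_sq (g : L2 Ω) : ∫ x in Ω, g x ^ 2 = ‖g‖ ^ 2 := by
  rw [← real_inner_self_eq_norm_sq, MeasureTheory.L2.inner_def]
  simp [sq]

theorem integrable_sq (g : L2 Ω) : Integrable (fun x => g x ^ 2) (volume.restrict Ω) :=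
  (Lp.memLp g).integrable_sq

theorem integral_gradSq (f : Sobolev N m Ω) :
    ∫ x in Ω, gradSq f x = if Even m then ‖lapPow f (m / 2) 0‖ ^ 2
      else ∑ i, ‖lapPow f (m / 2) (Pi.single i 1)‖ ^ 2 := by
  unfold gradSq
  split_ifs with h
  · exact integral_sq_eq_norm_sq _
  · rw [integral_finsetSum _ fun i _ => integrable_sq _]
    exact Finset.sum_congr rfl fun i _ => integral_sq_eq_norm_sq _

theorem integral_gradSq_nonneg (f : Sobolev N m Ω) : 0 ≤ ∫ x in Ω, gradSq f x := by
  rw [integral_gradSq]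
  split_ifs <;> positivity

theorem continuous_lapPow (k : ℕ) (α : Fin N → ℕ) :
    Continuous fun f : Sobolev N m Ω => lapPow f k α := by
  simp only [← lapPowL_apply]
  exact (lapPowL N m Ω k α).continuous

theorem continuous_integral_gradSq :
    Continuous fun f : Sobolev N m Ω => ∫ x in Ω, gradSq f x := by
  simp only [integral_gradSq]
  split_ifs
  · exact (continuous_lapPow _ _).norm.pow 2
  · exact continuous_finsetSum _ fun i _ => (continuous_lapPow _ _).norm.pow 2

/-! ### Test functions as elements of the Sobolev space -/

theorem integral_mul_partialD {D : Set (Eu N)} {φ ψ : Eu N → ℝ} (hφ : IsTestFunction D φ)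
    (hψ : IsTestFunction D ψ) (i : Fin N) :
    ∫ x, φ x * partialD i ψ x = - ∫ x, partialD i φ x * ψ x := by
  refine integral_mul_fderiv_eq_neg_fderiv_mul_of_integrable ?_ ?_ ?_
    (fun x _ => hφ.contDiff.differentiable (by simp) x)
    (fun x _ => hψ.contDiff.differentiable (by simp) x)
  · exact ((hφ.partialD i).memLp volume).integrable_mul (hψ.memLp volume)
  · exact (hφ.memLp volume).integrable_mul ((hψ.partialD i).memLp volume)
  · exact (hφ.memLp volume).integrable_mul (hψ.memLp volume)

theorem IsTestFunction.partialD_iterate {D : Set (Eu N)} {φ : Eu N → ℝ} (h : IsTestFunction D φ)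
    (i : Fin N) (k : ℕ) : IsTestFunction D ((HigherCapacity.partialD i)^[k] φ) := by
  induction k generalizing φ with
  | zero => exact h
  | succ k ih => exact ih (h.partialD i)

theorem IsTestFunction.listD {D : Set (Eu N)} {φ : Eu N → ℝ} (h : IsTestFunction D φ)
    (α : Fin N → ℕ) (l : List (Fin N)) : IsTestFunction D (listD l α φ) := by
  induction l with
  | nil => exact h
  | cons i l ih => exact ih.partialD_iterate i (α i)

theorem integral_mul_partialD_iterate {D : Set (Eu N)} {φ ψ : Eu N → ℝ} (hφ : IsTestFunction D φ)
    (hψ : IsTestFunction D ψ) (i : Fin N) (k : ℕ) :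
    ∫ x, φ x * (partialD i)^[k] ψ x = (-1) ^ k * ∫ x, (partialD i)^[k] φ x * ψ x := by
  induction k generalizing φ with
  | zero => simp
  | succ k ih =>
    simp only [Function.iterate_succ_apply' _ k ψ]
    rw [integral_mul_partialD hφ (hψ.partialD_iterate i k) i, ih (hφ.partialD i), pow_succ]
    simp

/-- Integration by parts peels off the outermost derivative first and so delivers the directions in
reverse order; this restores the order fixed by the list. -/
theorem listD_partialD_iterate_comm {D : Set (Eu N)} {φ : Eu N → ℝ} (hφ : IsTestFunction D φ)
    (α : Fin N → ℕ) (l : List (Fin N)) (i : Fin N) (k : ℕ) :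
    listD l α ((partialD i)^[k] φ) = (partialD i)^[k] (listD l α φ) := by
  induction k with
  | zero => rfl
  | succ k ih =>
    rw [Function.iterate_succ_apply', Function.iterate_succ_apply', ← ih]
    funext x
    exact listD_partialD_comm_eqOn isOpen_univ α l i
      ((hφ.partialD_iterate i k).contDiffOn _ _) (mem_univ x)

theorem integral_mul_multiD {D : Set (Eu N)} {φ ψ : Eu N → ℝ} (hφ : IsTestFunction D φ)
    (hψ : IsTestFunction D ψ) (α : Fin N → ℕ) :
    ∫ x, φ x * multiD α ψ x = (-1) ^ (∑ i, α i) * ∫ x, multiD α φ x * ψ x := by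
  rw [← sum_map_finRange, multiD_eq_listD, multiD_eq_listD]
  generalize List.finRange N = l
  induction l generalizing φ with
  | nil => simp [listD]
  | cons i l ih =>
    simp only [listD_cons, List.map_cons, List.sum_cons]
    rw [integral_mul_partialD_iterate hφ (hψ.listD α l), ih (hφ.partialD_iterate i (α i)),
      listD_partialD_iterate_comm hφ, pow_add, mul_assoc]

theorem exists_represents {φ : Eu N → ℝ} (hφ : IsTestFunction Ω φ) :
    ∃ f : Sobolev N m Ω, Represents φ f := by
  set F : Jet N m Ω := WithLp.toLp 1 fun α =>
    ((hφ.multiD α.1).memLp (volume.restrict Ω)).toLp (multiD α.1 φ) with hF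
  have hFα : ∀ α ∈ multiIndices N m, F.entry α =ᵐ[volume.restrict Ω] multiD α φ := by
    intro α hα
    rw [Jet.entry, dif_pos hα]
    exact MemLp.coeFn_toLp ((hφ.multiD α).memLp (volume.restrict Ω))
  refine ⟨⟨F, fun α hα ψ hψ => ?_⟩, hFα⟩
  have e0 : ∫ x in Ω, F.entry 0 x * multiD α ψ x = ∫ x, φ x * multiD α ψ x := by
    rw [← setIntegral_eq_integral_of_forall_compl_eq_zero (s := Ω)
      (f := fun x => φ x * multiD α ψ x) fun x hx => by rw [hφ.eq_zero hx, zero_mul]]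
    refine integral_congr_ae ?_
    filter_upwards [hFα 0 (mem_multiIndices.2 (by simp))] with x hx
    rw [hx, multiD_zero]
  have e1 : ∫ x in Ω, F.entry α x * ψ x = ∫ x, multiD α φ x * ψ x := by
    rw [← setIntegral_eq_integral_of_forall_compl_eq_zero (s := Ω)
      (f := fun x => multiD α φ x * ψ x) fun x hx => by rw [hψ.eq_zero hx, mul_zero]]
    refine integral_congr_ae ?_
    filter_upwards [hFα α hα] with x hx
    rw [hx]
  rw [e0, e1, integral_mul_multiD hφ hψ]

theorem IsTestFunction.isNavierCm (hΩ : IsOpen Ω) {φ : Eu N → ℝ} (hφ : IsTestFunction Ω φ) :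
    IsNavierCm m Ω φ := by
  refine ⟨⟨hφ.contDiffOn _ _, fun α _ => ⟨HigherCapacity.multiD α φ,
    (hφ.multiD α).contDiff.continuous.continuousOn, fun x _ => rfl⟩⟩, fun j _ p hp => ?_⟩
  have e : (Laplacian.laplacian (F := Eu N → ℝ))^[j] φ = HigherCapacity.lapl^[j] φ :=
    funext fun x => laplacian_iterate_eqOn_lapl isOpen_univ (hφ.contDiffOn _ _) (mem_univ x)
  have hp' : p ∉ Ω := by
    rw [hΩ.frontier_eq] at hp
    exact hp.2
  rw [e, ← (hφ.lapl_iterate j).eq_zero hp']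
  exact ((hφ.lapl_iterate j).contDiff.continuous.tendsto p).mono_left nhdsWithin_le_nhds

theorem IsTestFunction.isX (hΩ : IsOpen Ω) {φ : Eu N → ℝ} (hφ : IsTestFunction Ω φ)
    (bc : BoundaryCondition) : IsX bc m Ω φ := by
  cases bc
  · exact hφ
  · exact hφ.isNavierCm hΩ

/-- Test functions satisfy the Navier conditions, so coercivity has to be proved for the Navier
class only. -/
theorem IsX.isNavierCm (hΩ : IsOpen Ω) {bc : BoundaryCondition} {u : Eu N → ℝ}
    (hu : IsX bc m Ω u) : IsNavierCm m Ω u := by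
  cases bc
  · exact IsTestFunction.isNavierCm hΩ hu
  · exact hu

theorem IsTestFunction.isX₀ (hΩ : IsOpen Ω) {x₀ : Eu N} {φ : Eu N → ℝ}
    (hφ : IsTestFunction Ω φ) (h0 : ∀ᶠ x in 𝓝 x₀, φ x = 0) (bc : BoundaryCondition) :
    IsX₀ bc m Ω {x₀} φ := by
  cases bc
  · refine ⟨hφ.contDiff, hφ.hasCompactSupport, fun x hx => ⟨hφ.tsupport_subset hx, ?_⟩⟩
    rintro rfl
    exact (notMem_tsupport_iff_eventuallyEq.2 h0) hx
  · exact ⟨hφ.isNavierCm hΩ, by rwa [nhdsSet_singleton]⟩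

theorem IsX₀.eventually_eq_zero {x₀ : Eu N} {bc : BoundaryCondition} {u : Eu N → ℝ}
    (hu : IsX₀ bc m Ω {x₀} u) : ∀ᶠ x in 𝓝 x₀, u x = 0 := by
  cases bc
  · have h : IsTestFunction (Ω \ {x₀}) u := hu
    exact notMem_tsupport_iff_eventuallyEq.1 fun hx => (h.tsupport_subset hx).2 rfl
  · have := hu.2
    rwa [nhdsSet_singleton] at this

theorem Represents.sub (hΩ : IsOpen Ω) {u v : Eu N → ℝ} {f g : Sobolev N m Ω}
    (hu : ContDiffOn ℝ m u Ω) (hv : ContDiffOn ℝ m v Ω) (hf : Represents u f)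
    (hg : Represents v g) : Represents (fun x => u x - v x) (f - g) := by
  intro α hα
  have hα' := mem_multiIndices.1 hα
  have e : weakD (f - g) α = weakD f α - weakD g α := by
    simp only [← weakDL_apply, map_sub]
  rw [e]
  filter_upwards [hf α hα, hg α hα, Lp.coeFn_sub (weakD f α) (weakD g α),
    ae_restrict_mem hΩ.measurableSet] with x h1 h2 h3 hx
  rw [h3, Pi.sub_apply, h1, h2]
  -- The difference is treated as a sum over `Fin 2`, so that additivity of `multiD` over finite
  -- sums applies.
  have h4 := multiD_sum_eqOn hΩ Finset.univ (u := ![u, fun x => (-1) * v x]) α (fun k _ => by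
    fin_cases k
    · exact hu.of_le (by exact_mod_cast hα')
    · exact contDiffOn_const.mul (hv.of_le (by exact_mod_cast hα'))) hx
  have h5 : multiD α (fun x => (-1) * v x) x = - multiD α v x := by
    have : ∀ l : List (Fin N), listD l α (fun x => (-1) * v x) = fun x => (-1) * listD l α v x := by
      intro l
      induction l with
      | nil => rfl
      | cons i l ih =>
        rw [listD_cons, listD_cons, ih]
        induction α i generalizing l with
        | zero => rfl
        | succ k ihk =>
          rw [Function.iterate_succ_apply', Function.iterate_succ_apply', ihk l ih,
            partialD_const_mul]
    rw [multiD_eq_listD, this]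
    simp [multiD_eq_listD]
  simp only [Fin.sum_univ_two, Matrix.cons_val_zero, Matrix.cons_val_one, h5] at h4
  rw [← sub_eq_add_neg] at h4
  rw [← h4]
  congr 2
  funext y
  ring

/-! ### The classical energy density -/

/-- `|∇^m u|²` for a function `u` of class `C^m`. -/
def gradSqFun (m : ℕ) (u : Eu N → ℝ) (x : Eu N) : ℝ :=
  if Even m then (lapl^[m / 2] u x) ^ 2
  else ∑ i, (partialD i (lapl^[m / 2] u) x) ^ 2

theorem gradSqFun_nonneg (m : ℕ) (u : Eu N → ℝ) (x : Eu N) : 0 ≤ gradSqFun m u x := by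
  unfold gradSqFun
  split_ifs <;> positivity

theorem two_mul_half_add_one_le {m : ℕ} (h : ¬ Even m) : 2 * (m / 2) + 1 ≤ m := by
  have := Nat.not_even_iff.1 h
  omega

theorem lapPow_zero_ae_eq (hΩ : IsOpen Ω) {u : Eu N → ℝ} (hu : ContDiffOn ℝ m u Ω)
    {f : Sobolev N m Ω} (hf : Represents u f) {k : ℕ} (hk : 2 * k ≤ m) :
    lapPow f k 0 =ᵐ[volume.restrict Ω] lapl^[k] u := by
  simpa only [multiD_zero] using lapPow_ae_eq hΩ hu hf k 0 (by simpa using hk)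

theorem lapPow_single_ae_eq (hΩ : IsOpen Ω) {u : Eu N → ℝ} (hu : ContDiffOn ℝ m u Ω)
    {f : Sobolev N m Ω} (hf : Represents u f) {k : ℕ} (hk : 2 * k + 1 ≤ m) (i : Fin N) :
    lapPow f k (Pi.single i 1) =ᵐ[volume.restrict Ω] partialD i (lapl^[k] u) := by
  filter_upwards [lapPow_ae_eq hΩ hu hf k (Pi.single i 1) (by simpa using hk),
    ae_restrict_mem hΩ.measurableSet] with x hx hxΩ
  rw [hx]
  exact multiD_single_eqOn hΩ i (contDiffOn_lapl_iterate hΩ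
    (hu.of_le (by norm_cast; omega))) hxΩ

theorem gradSq_ae_eq (hΩ : IsOpen Ω) {u : Eu N → ℝ} (hu : ContDiffOn ℝ m u Ω)
    {f : Sobolev N m Ω} (hf : Represents u f) :
    gradSq f =ᵐ[volume.restrict Ω] gradSqFun m u := by
  by_cases h : Even m
  · filter_upwards [lapPow_zero_ae_eq hΩ hu hf (Nat.mul_div_le m 2)] with x hx
    simp only [gradSq, gradSqFun, if_pos h, hx]
  · filter_upwards [ae_all_iff.2 fun i =>
      lapPow_single_ae_eq hΩ hu hf (two_mul_half_add_one_le h) i] with x hx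
    simp only [gradSq, gradSqFun, if_neg h, hx]

theorem IsTestFunction.integrable_sq {D : Set (Eu N)} {φ : Eu N → ℝ} (h : IsTestFunction D φ)
    (μ : Measure (Eu N)) [IsFiniteMeasureOnCompacts μ] : Integrable (fun x => φ x ^ 2) μ :=
  (h.memLp μ).integrable_sq

theorem IsTestFunction.integrable_gradSqFun {D : Set (Eu N)} {φ : Eu N → ℝ}
    (h : IsTestFunction D φ) (m : ℕ) : Integrable (gradSqFun m φ) := by
  by_cases hm : Even m
  · have e : gradSqFun m φ = fun x => (HigherCapacity.lapl^[m / 2] φ x) ^ 2 := by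
      funext x
      simp only [gradSqFun, if_pos hm]
    rw [e]
    exact (h.lapl_iterate _).integrable_sq volume
  · have e : gradSqFun m φ = fun x =>
        ∑ i, (HigherCapacity.partialD i (HigherCapacity.lapl^[m / 2] φ) x) ^ 2 := by
      funext x
      simp only [gradSqFun, if_neg hm]
    rw [e]
    exact integrable_finsetSum _ fun i _ =>
      ((h.lapl_iterate _).partialD i).integrable_sq volume

/-! ### Vanishing capacity -/

theorem capV_nonneg (bc : BoundaryCondition) (m : ℕ) (Ω K : Set (Eu N)) (η : Eu N → ℝ) :
    0 ≤ capV bc m Ω K η := by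
  refine Real.sInf_nonneg ?_
  rintro c ⟨f, h, -, -, -, rfl⟩
  exact integral_gradSq_nonneg f

/-- Both `φ` and `η` equal `1` near `x₀`, so `φ - η` vanishes there and `φ` is itself a competitor,
before any closure is taken. -/
theorem capV_le_of_isTestFunction (hΩ : IsOpen Ω) {x₀ : Eu N} {η : Eu N → ℝ}
    (hη : IsCutoff Ω {x₀} η) (bc : BoundaryCondition) {φ : Eu N → ℝ} (hφ : IsTestFunction Ω φ)
    (h1 : ∀ᶠ x in 𝓝 x₀, φ x = 1) : capV bc m Ω {x₀} η ≤ ∫ x, gradSqFun m φ x := by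
  obtain ⟨f, hf⟩ := exists_represents (m := m) hφ
  obtain ⟨h, hh⟩ := exists_represents (m := m) hη.1
  have hη1 := hη.2
  rw [nhdsSet_singleton] at hη1
  have hsub : IsTestFunction Ω (fun x => φ x - η x) := by
    have := isTestFunction_sum (D := Ω) Finset.univ (φ := ![φ, fun x => (-1) * η x])
      (fun k _ => by
        fin_cases k
        · exact hφ
        · exact hη.1.const_mul (-1))
    convert this using 2
    simp [Fin.sum_univ_two, sub_eq_add_neg]
  have hle : capV bc m Ω {x₀} η ≤ ∫ x in Ω, gradSq f x := by
    refine csInf_le ⟨0, ?_⟩ ⟨f, h, subset_closure ⟨φ, hφ.isX hΩ bc, hf⟩, hh,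
      subset_closure ⟨_, hsub.isX₀ hΩ ?_ bc,
        hf.sub hΩ (hφ.contDiffOn _ _) (hη.1.contDiffOn _ _) hh⟩, rfl⟩
    · rintro c ⟨f, h, -, -, -, rfl⟩
      exact integral_gradSq_nonneg f
    · filter_upwards [h1, hη1] with x h2 h3
      rw [h2, h3, sub_self]
  refine hle.trans ?_
  rw [integral_congr_ae (gradSq_ae_eq hΩ (hφ.contDiffOn _ _) hf)]
  exact setIntegral_le_integral (hφ.integrable_gradSqFun m)
    (Eventually.of_forall (gradSqFun_nonneg m φ))

/-- The function `x ↦ u(c (x - x₀))`. -/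
def rescale (x₀ : Eu N) (c : ℝ) (u : Eu N → ℝ) : Eu N → ℝ := fun x => u (c • (x - x₀))

theorem partialD_rescale (x₀ : Eu N) (c : ℝ) (u : Eu N → ℝ) (i : Fin N) :
    partialD i (rescale x₀ c u) = fun x => c * rescale x₀ c (partialD i u) x := by
  funext x
  have h1 : fderiv ℝ (rescale x₀ c u) x = fderiv ℝ (fun z => u (c • z)) (x - x₀) :=
    fderiv_comp_sub (f := fun z => u (c • z)) x₀
  simp only [partialD, h1, rescale]
  rw [fderiv_comp_smul]
  rfl

theorem lapl_rescale (x₀ : Eu N) (c : ℝ) (u : Eu N → ℝ) :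
    lapl (rescale x₀ c u) = fun x => c ^ 2 * rescale x₀ c (lapl u) x := by
  funext x
  simp only [lapl, partialD_rescale, partialD_const_mul]
  simp only [rescale, lapl, Finset.mul_sum]
  exact Finset.sum_congr rfl fun i _ => by ring

theorem lapl_const_mul (c : ℝ) (u : Eu N → ℝ) :
    lapl (fun x => c * u x) = fun x => c * lapl u x := by
  funext x
  simp only [lapl, partialD_const_mul, Finset.mul_sum]

theorem lapl_iterate_rescale (x₀ : Eu N) (c : ℝ) (u : Eu N → ℝ) (k : ℕ) :
    lapl^[k] (rescale x₀ c u) = fun x => c ^ (2 * k) * rescale x₀ c (lapl^[k] u) x := by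
  induction k with
  | zero => simp
  | succ k ih =>
    rw [Function.iterate_succ_apply', ih, lapl_const_mul, lapl_rescale,
      Function.iterate_succ_apply']
    funext x
    ring

/-- Combined with the factor `c ^ (-N)` from `integral_rescale`, this is the origin of the threshold
`N = 2m`. -/
theorem gradSqFun_rescale (m : ℕ) (x₀ : Eu N) (c : ℝ) (u : Eu N → ℝ) :
    gradSqFun m (rescale x₀ c u) = fun x => c ^ (2 * m) * rescale x₀ c (gradSqFun m u) x := by
  funext x
  by_cases h : Even m
  · obtain ⟨k, rfl⟩ := h
    simp only [gradSqFun, if_pos (Even.add_self k), lapl_iterate_rescale, rescale]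
    rw [show (k + k) / 2 = k by omega]
    ring
  · simp only [gradSqFun, if_neg h, lapl_iterate_rescale, partialD_const_mul, partialD_rescale]
    obtain ⟨k, rfl⟩ := Nat.not_even_iff_odd.1 h
    have e : (2 * k + 1) / 2 = k := by omega
    simp only [e, rescale, gradSqFun, if_neg h]
    rw [Finset.mul_sum]
    refine Finset.sum_congr rfl fun i _ => ?_
    ring

theorem integral_rescale (x₀ : Eu N) {c : ℝ} (hc : 0 < c) (g : Eu N → ℝ) :
    ∫ x, rescale x₀ c g x = (c ^ N)⁻¹ * ∫ x, g x := by
  have h1 := integral_sub_right_eq_self (μ := (volume : Measure (Eu N)))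
    (fun x => g (c • x)) x₀
  have h2 := Measure.integral_comp_smul (volume : Measure (Eu N)) g c
  rw [finrank_euclideanSpace_fin, abs_of_pos (by positivity), smul_eq_mul] at h2
  rw [← h2, ← h1]
  rfl

theorem lapl_sum_const_mul {ι : Type*} (s : Finset ι) {u : ι → Eu N → ℝ} (c : ℝ)
    (hu : ∀ k ∈ s, ContDiff ℝ ∞ (u k)) :
    lapl (fun x => c * ∑ k ∈ s, u k x) = fun x => c * ∑ k ∈ s, lapl (u k) x := by
  have h2 : ∀ k ∈ s, ∀ n : ℕ, ContDiffOn ℝ n (u k) univ := fun k hk n =>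
    ((hu k hk).of_le (by exact_mod_cast le_top)).contDiffOn
  have e1 : ∀ i : Fin N, partialD i (fun x => ∑ k ∈ s, u k x) =
      fun x => ∑ k ∈ s, partialD i (u k) x := fun i =>
    funext fun x => partialD_sum_eqOn isOpen_univ s (fun k hk => h2 k hk _) i (mem_univ x)
  have e2 : ∀ i : Fin N, partialD i (fun x => ∑ k ∈ s, partialD i (u k) x) =
      fun x => ∑ k ∈ s, partialD i (partialD i (u k)) x := fun i =>
    funext fun x => partialD_sum_eqOn isOpen_univ s
      (fun k hk => contDiffOn_partialD isOpen_univ (h2 k hk _) i) i (mem_univ x)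
  rw [lapl_const_mul]
  funext x
  simp only [lapl, e1, e2]
  rw [Finset.sum_comm]

theorem lapl_iterate_sum_const_mul {ι : Type*} (s : Finset ι) {u : ι → Eu N → ℝ} (c : ℝ)
    (hu : ∀ k ∈ s, ContDiff ℝ ∞ (u k)) (n : ℕ) :
    lapl^[n] (fun x => c * ∑ k ∈ s, u k x) = fun x => c * ∑ k ∈ s, lapl^[n] (u k) x := by
  induction n with
  | zero => rfl
  | succ n ih =>
    simp only [Function.iterate_succ_apply']
    rw [ih, lapl_sum_const_mul s c fun k hk => contDiff_lapl_iterate (hu k hk) n]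

theorem lapl_iterate_eventually_zero {u : Eu N → ℝ} {c : ℝ} {x : Eu N}
    (h : ∀ᶠ y in 𝓝 x, u y = c) {k : ℕ} (hk : 1 ≤ k) : ∀ᶠ y in 𝓝 x, lapl^[k] u y = 0 := by
  have step : ∀ {v : Eu N → ℝ} {d : ℝ}, (∀ᶠ y in 𝓝 x, v y = d) →
      ∀ᶠ y in 𝓝 x, lapl v y = 0 := by
    intro v d hv
    filter_upwards [eventually_all.2 fun i => partialD_eq_zero_of_eventually_const
      (partialD_eq_zero_of_eventually_const hv i) i] with y hy
    exact Finset.sum_eq_zero fun i _ => hy i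
  induction k, hk using Nat.le_induction with
  | base => exact step h
  | succ k _ ih =>
    rw [Function.iterate_succ_apply']
    exact step ih

theorem sq_sum_eq_sum_sq {ι : Type*} (s : Finset ι) (a : ι → ℝ)
    (h : ∀ k ∈ s, ∀ l ∈ s, k ≠ l → a k * a l = 0) : (∑ k ∈ s, a k) ^ 2 = ∑ k ∈ s, a k ^ 2 := by
  rw [sq, Finset.sum_mul_sum]
  refine Finset.sum_congr rfl fun k hk => ?_
  rw [Finset.sum_eq_single k (fun l hl hlk => h k hk l hl hlk.symm) (fun h => absurd hk h), sq]

/-- Functions of which, near any point, all but one are constant have orthogonal energies. -/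
theorem gradSqFun_sum_const_mul {ι : Type*} (s : Finset ι) {u : ι → Eu N → ℝ} (c : ℝ)
    (hm : 1 ≤ m) (hu : ∀ k ∈ s, ContDiff ℝ ∞ (u k)) {x : Eu N}
    (hloc : ∀ k ∈ s, ∀ l ∈ s, k ≠ l →
      (∃ d, ∀ᶠ y in 𝓝 x, u k y = d) ∨ ∃ d, ∀ᶠ y in 𝓝 x, u l y = d) :
    gradSqFun m (fun x => c * ∑ k ∈ s, u k x) x = c ^ 2 * ∑ k ∈ s, gradSqFun m (u k) x := by
  by_cases h : Even m
  · have hk : 1 ≤ m / 2 := by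
      obtain ⟨k, rfl⟩ := h
      omega
    simp only [gradSqFun, if_pos h, lapl_iterate_sum_const_mul s c hu, mul_pow]
    rw [sq_sum_eq_sum_sq]
    intro k hks l hls hkl
    rcases hloc k hks l hls hkl with ⟨d, hd⟩ | ⟨d, hd⟩
    · rw [(lapl_iterate_eventually_zero hd hk).self_of_nhds, zero_mul]
    · rw [(lapl_iterate_eventually_zero hd hk).self_of_nhds, mul_zero]
  · have hz : ∀ {v : Eu N → ℝ} {d : ℝ}, (∀ᶠ y in 𝓝 x, v y = d) → ∀ i,
        partialD i (lapl^[m / 2] v) x = 0 := by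
      intro v d hv i
      -- For `m = 1` no Laplacian is applied, and only the outer gradient annihilates the locally
      -- constant function.
      rcases Nat.eq_zero_or_pos (m / 2) with h0 | h0
      · rw [h0]
        exact (partialD_eq_zero_of_eventually_const hv i).self_of_nhds
      · exact (partialD_eq_zero_of_eventually_const
          (lapl_iterate_eventually_zero hv h0) i).self_of_nhds
    simp only [gradSqFun, if_neg h, lapl_iterate_sum_const_mul s c hu, partialD_const_mul]
    rw [Finset.sum_comm, Finset.mul_sum]
    refine Finset.sum_congr rfl fun i _ => ?_
    rw [partialD_sum_eqOn isOpen_univ s (fun k hk =>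
      ((contDiff_lapl_iterate (hu k hk) _).of_le (by exact_mod_cast le_top)).contDiffOn) i
      (mem_univ x), mul_pow, sq_sum_eq_sum_sq]
    intro k hks l hls hkl
    rcases hloc k hks l hls hkl with ⟨d, hd⟩ | ⟨d, hd⟩
    · rw [hz hd, zero_mul]
    · rw [hz hd, mul_zero]

theorem capV_singleton_eq_zero (hΩ : IsOpen Ω) {x₀ : Eu N} (hx₀ : x₀ ∈ Ω) {η : Eu N → ℝ}
    (hη : IsCutoff Ω {x₀} η) (bc : BoundaryCondition) (hm : 1 ≤ m) (hN : 2 * m ≤ N) :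
    capV bc m Ω {x₀} η = 0 := by
  obtain ⟨R, hR, hRΩ⟩ := Metric.nhds_basis_closedBall.mem_iff.1 (hΩ.mem_nhds hx₀)
  let b : ContDiffBump (0 : Eu N) := ⟨1, 2, one_pos, one_lt_two⟩
  -- `2 * r ≤ R` keeps the supports in the ball, since the bump has outer radius `2`; `r ≤ 1` makes
  -- all dilation factors at least `1`.
  set r : ℝ := min (R / 2) 1 with hr
  have hr0 : 0 < r := by positivity
  have hr1 : r ≤ 1 := min_le_right _ _
  have hr2 : 2 * r ≤ R := by linarith [min_le_left (R / 2) 1]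
  -- The ratio `4` exceeds the ratio `2` of the radii of the bump, which makes the transition shells
  -- disjoint.
  set c : ℕ → ℝ := fun k => 4 ^ k / r with hc
  have hc0 : ∀ k, 0 < c k := fun k => by positivity
  have hc1 : ∀ k, 1 ≤ c k := fun k => by
    rw [hc, le_div_iff₀ hr0, one_mul]
    exact hr1.trans (one_le_pow₀ (by norm_num))
  set φ : ℕ → Eu N → ℝ := fun k => rescale x₀ (c k) b with hφdef
  have hb : IsTestFunction univ (b : Eu N → ℝ) :=
    ⟨b.contDiff, b.hasCompactSupport, subset_univ _⟩
  have hone : ∀ k x, c k * ‖x - x₀‖ < 1 → ∀ᶠ y in 𝓝 x, φ k y = 1 := by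
    intro k x hx
    have hcont : Continuous fun y : Eu N => c k * ‖y - x₀‖ := by fun_prop
    filter_upwards [hcont.continuousAt.eventually_lt continuousAt_const hx] with y hy
    refine b.one_of_mem_closedBall ?_
    rw [mem_closedBall_zero_iff, norm_smul, Real.norm_of_nonneg (hc0 k).le]
    exact hy.le
  have hzero' : ∀ k x, 2 ≤ c k * ‖x - x₀‖ → φ k x = 0 := by
    intro k x hx
    refine b.zero_of_le_dist ?_
    rw [dist_zero_right, norm_smul, Real.norm_of_nonneg (hc0 k).le]
    exact hx
  have hzero : ∀ k x, 2 < c k * ‖x - x₀‖ → ∀ᶠ y in 𝓝 x, φ k y = 0 := by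
    intro k x hx
    have hcont : Continuous fun y : Eu N => c k * ‖y - x₀‖ := by fun_prop
    filter_upwards [continuousAt_const.eventually_lt hcont.continuousAt hx] with y hy
    exact hzero' k y hy.le
  have hφs : ∀ k, ContDiff ℝ ∞ (φ k) := fun k =>
    b.contDiff.comp (by fun_prop : ContDiff ℝ ∞ fun x : Eu N => c k • (x - x₀))
  have hφt : ∀ k, IsTestFunction Ω (φ k) := by
    intro k
    have hsub : Function.support (φ k) ⊆ Metric.closedBall x₀ R := by
      intro x hx
      rw [Metric.mem_closedBall, dist_eq_norm]
      by_contra! hlt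
      refine hx (hzero' k x ?_)
      have h1 : 1 / r ≤ c k := by
        simp only [hc]
        gcongr
        exact one_le_pow₀ (by norm_num)
      calc (2 : ℝ) = 1 / r * (2 * r) := by field_simp
        _ ≤ c k * ‖x - x₀‖ := by
          refine mul_le_mul h1 (by linarith) (by positivity) (hc0 k).le
    have hts : tsupport (φ k) ⊆ Metric.closedBall x₀ R :=
      closure_minimal hsub Metric.isClosed_closedBall
    exact ⟨hφs k, (isCompact_closedBall x₀ R).of_isClosed_subset (isClosed_tsupport _) hts,
      hts.trans hRΩ⟩
  set E : ℝ := ∫ x, gradSqFun m (b : Eu N → ℝ) x with hE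
  have hE0 : 0 ≤ E := integral_nonneg (gradSqFun_nonneg m _)
  have hEk : ∀ k, ∫ x, gradSqFun m (φ k) x ≤ E := by
    intro k
    rw [hφdef]
    simp only
    rw [gradSqFun_rescale, integral_const_mul, integral_rescale x₀ (hc0 k), ← mul_assoc]
    refine mul_le_of_le_one_left hE0 ?_
    rw [← div_eq_mul_inv, div_le_one (by have := hc0 k; positivity)]
    -- Here `2m ≤ N` enters: `c ^ (2m) ≤ c ^ N` because `c ≥ 1`.
    exact pow_le_pow_right₀ (hc1 k) hN
  have hloc : ∀ x k l, k < l →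
      (∃ d, ∀ᶠ y in 𝓝 x, φ k y = d) ∨ ∃ d, ∀ᶠ y in 𝓝 x, φ l y = d := by
    intro x k l hkl
    -- Either `x` lies in the open inner ball of the wider bump, or `c l * ‖x - x₀‖ ≥ 4 > 2` and `x`
    -- is off the support of the narrower one.
    by_cases h : c k * ‖x - x₀‖ < 1
    · exact Or.inl ⟨1, hone k x h⟩
    · refine Or.inr ⟨0, hzero l x ?_⟩
      have h4 : 4 * c k ≤ c l := by
        simp only [hc]
        rw [← mul_div_assoc, ← pow_succ']
        gcongr
        · norm_num
        · exact hkl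
      nlinarith [norm_nonneg (x - x₀)]
  have hbound : ∀ n : ℕ, capV bc m Ω {x₀} η ≤ E / ((n : ℝ) + 1) := by
    intro n
    set a : ℝ := 1 / ((n : ℝ) + 1) with ha
    have ha0 : 0 < (n : ℝ) + 1 := by positivity
    have ht : IsTestFunction Ω (fun x => a * ∑ k ∈ Finset.range (n + 1), φ k x) :=
      (isTestFunction_sum _ fun k _ => hφt k).const_mul a
    have h1 : ∀ᶠ x in 𝓝 x₀, a * ∑ k ∈ Finset.range (n + 1), φ k x = 1 := by
      have : ∀ᶠ x in 𝓝 x₀, ∀ k ∈ Finset.range (n + 1), φ k x = 1 :=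
        (Finset.eventually_all _).2 fun k _ => hone k x₀ (by simp)
      filter_upwards [this] with x hx
      rw [Finset.sum_congr rfl hx, ha]
      simp
      field_simp
    refine (capV_le_of_isTestFunction hΩ hη bc ht h1).trans ?_
    -- There are no cross terms: `n + 1` energies of size at most `E`, weighted by `1 / (n + 1)²`,
    -- leave `E / (n + 1)`.
    have e : gradSqFun m (fun x => a * ∑ k ∈ Finset.range (n + 1), φ k x) =
        fun x => a ^ 2 * ∑ k ∈ Finset.range (n + 1), gradSqFun m (φ k) x := by
      funext x
      refine gradSqFun_sum_const_mul _ a hm (fun k _ => hφs k) fun k _ l _ hkl => ?_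
      rcases lt_or_gt_of_ne hkl with h | h
      · exact hloc x k l h
      · exact (hloc x l k h).symm
    rw [e, integral_const_mul, integral_finsetSum _ fun k _ => (hφt k).integrable_gradSqFun m]
    calc a ^ 2 * ∑ k ∈ Finset.range (n + 1), ∫ x, gradSqFun m (φ k) x
        ≤ a ^ 2 * ∑ _k ∈ Finset.range (n + 1), E := by
          gcongr with k _
          exact hEk k
      _ = E / ((n : ℝ) + 1) := by
          rw [Finset.sum_const, Finset.card_range, nsmul_eq_mul, ha]
          push_cast
          field_simp
  refine le_antisymm ?_ (capV_nonneg bc m Ω _ η)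
  have hlim : Tendsto (fun n : ℕ => E / ((n : ℝ) + 1)) atTop (𝓝 0) := by
    have := (tendsto_one_div_add_atTop_nhds_zero_nat (𝕜 := ℝ)).const_mul E
    simpa [div_eq_mul_inv] using this
  exact ge_of_tendsto' hlim hbound

/-! ### A smooth truncation -/

/-- The derivative of `truncation`. -/
def truncationDeriv (s : ℝ) : ℝ := min (max (|s| - 1) 0) 1

/-- A monotone `C^1` function vanishing on `[-1, 1]`, at bounded distance from the identity. -/
def truncation (s : ℝ) : ℝ := ∫ t in (0 : ℝ)..s, truncationDeriv t

theorem continuous_truncationDeriv : Continuous truncationDeriv := by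
  unfold truncationDeriv
  fun_prop

theorem truncationDeriv_nonneg (s : ℝ) : 0 ≤ truncationDeriv s :=
  le_min (le_max_right _ _) zero_le_one

theorem truncationDeriv_le_one (s : ℝ) : truncationDeriv s ≤ 1 := min_le_right _ _

theorem hasDerivAt_truncation (s : ℝ) : HasDerivAt truncation (truncationDeriv s) s :=
  intervalIntegral.integral_hasDerivAt_right
    (continuous_truncationDeriv.intervalIntegrable _ _)
    (continuous_truncationDeriv.stronglyMeasurableAtFilter _ _)
    continuous_truncationDeriv.continuousAt

theorem contDiff_truncation : ContDiff ℝ 1 truncation := by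
  refine contDiff_one_iff_deriv.2 ⟨fun s => (hasDerivAt_truncation s).differentiableAt, ?_⟩
  rw [show deriv truncation = truncationDeriv from funext fun s => (hasDerivAt_truncation s).deriv]
  exact continuous_truncationDeriv

theorem truncation_neg (s : ℝ) : truncation (-s) = - truncation s := by
  have h : ∀ t, truncationDeriv (-t) = truncationDeriv t := fun t => by
    simp [truncationDeriv]
  have h1 := intervalIntegral.integral_comp_neg (a := 0) (b := s) truncationDeriv
  simp only [h, neg_zero] at h1
  rw [truncation, truncation, h1, intervalIntegral.integral_symm]

theorem truncation_eq_zero {s : ℝ} (hs : |s| ≤ 1) : truncation s = 0 := by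
  rw [truncation, intervalIntegral.integral_zero_ae]
  refine Eventually.of_forall fun t ht => ?_
  have : |t| ≤ |s| := by
    rcases mem_uIoc.1 ht with h | h
    · rw [abs_of_pos h.1, abs_of_pos (h.1.trans_le h.2)]
      exact h.2
    · rw [abs_of_nonpos h.2, abs_of_neg (h.1.trans_le h.2)]
      linarith [h.1]
  rw [truncationDeriv, max_eq_right (by linarith), min_eq_left zero_le_one]

theorem truncation_mem_Icc {s : ℝ} (hs : 0 ≤ s) : truncation s ∈ Icc (max 0 (s - 2)) s := by
  have hi : ∀ a b, IntervalIntegrable truncationDeriv volume a b := fun a b =>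
    continuous_truncationDeriv.intervalIntegrable a b
  have h0 : 0 ≤ truncation s :=
    intervalIntegral.integral_nonneg hs fun t _ => truncationDeriv_nonneg t
  have h1 : truncation s ≤ s := by
    have := intervalIntegral.integral_mono_on hs (hi 0 s) (g := fun _ => (1 : ℝ))
      (continuous_const.intervalIntegrable _ _) fun t _ => truncationDeriv_le_one t
    simpa [truncation] using this
  refine ⟨max_le h0 ?_, h1⟩
  rcases le_total s 2 with h | h
  · linarith
  · have e : truncation s = (∫ t in (0 : ℝ)..2, truncationDeriv t) +
        ∫ t in (2 : ℝ)..s, truncationDeriv t :=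
      (intervalIntegral.integral_add_adjacent_intervals (hi _ _) (hi _ _)).symm
    have h2 : ∫ t in (2 : ℝ)..s, truncationDeriv t = ∫ _t in (2 : ℝ)..s, (1 : ℝ) := by
      refine intervalIntegral.integral_congr fun t ht => ?_
      rw [uIcc_of_le h] at ht
      have : 1 ≤ |t| - 1 := by
        rw [abs_of_nonneg (by linarith [ht.1])]
        linarith [ht.1]
      simp only [truncationDeriv]
      rw [max_eq_left (by linarith), min_eq_right this]
    have h3 : 0 ≤ ∫ t in (0 : ℝ)..2, truncationDeriv t :=
      intervalIntegral.integral_nonneg zero_le_two fun t _ => truncationDeriv_nonneg t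
    rw [e, h2]
    simp
    linarith

theorem abs_truncation_le (s : ℝ) : |truncation s| ≤ |s| := by
  rcases le_total 0 s with h | h
  · have := truncation_mem_Icc h
    rw [abs_of_nonneg ((le_max_left _ _).trans this.1), abs_of_nonneg h]
    exact this.2
  · have := truncation_mem_Icc (neg_nonneg.2 h)
    rw [← abs_neg, ← truncation_neg, abs_of_nonneg ((le_max_left _ _).trans this.1),
      abs_of_nonpos h]
    exact this.2

/-- After rescaling, `ε * truncation (v / ε)` is within `2 * ε` of `v`, so the truncations converge
to `v`. -/
theorem abs_truncation_sub_le (s : ℝ) : |truncation s - s| ≤ 2 := by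
  have key : ∀ t : ℝ, 0 ≤ t → |truncation t - t| ≤ 2 := fun t ht => by
    have := truncation_mem_Icc ht
    rw [abs_le]
    constructor <;> linarith [this.2, (le_max_right _ _).trans this.1]
  rcases le_total 0 s with h | h
  · exact key s h
  · have := key (-s) (neg_nonneg.2 h)
    rw [truncation_neg, ← abs_neg] at this
    convert this using 2
    ring

/-! ### Poincaré inequalities for functions with vanishing boundary values -/

/-- The factor `w` vanishes near every point outside `Ω`, so the behaviour of `g` at the boundary is
irrelevant. -/
theorem continuous_mul_of_tsupport_subset (hΩ : IsOpen Ω) {w g : Eu N → ℝ} (hw : Continuous w)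
    (hws : tsupport w ⊆ Ω) (hg : ContinuousOn g Ω) : Continuous fun x => w x * g x := by
  refine continuous_iff_continuousAt.2 fun x => ?_
  by_cases hx : x ∈ Ω
  · exact hw.continuousAt.mul (hg.continuousAt (hΩ.mem_nhds hx))
  · have h0 : w =ᶠ[𝓝 x] 0 := notMem_tsupport_iff_eventuallyEq.1 fun h => hx (hws h)
    have : (fun x => w x * g x) =ᶠ[𝓝 x] fun _ => 0 := by
      filter_upwards [h0] with y hy
      rw [hy, Pi.zero_apply, zero_mul]
    exact this.continuousAt

theorem integrable_mul_of_tsupport_subset (hΩ : IsOpen Ω) {w g : Eu N → ℝ} (hw : Continuous w)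
    (hwc : HasCompactSupport w) (hws : tsupport w ⊆ Ω) (hg : ContinuousOn g Ω) :
    Integrable fun x => w x * g x :=
  (continuous_mul_of_tsupport_subset hΩ hw hws hg).integrable_of_hasCompactSupport hwc.mul_right

theorem continuous_partialD {w : Eu N → ℝ} (hw : ContDiff ℝ 1 w) (i : Fin N) :
    Continuous (partialD i w) :=
  (hw.continuous_fderiv (by simp)).clm_apply continuous_const

theorem hasCompactSupport_partialD {w : Eu N → ℝ} (hw : HasCompactSupport w) (i : Fin N) :
    HasCompactSupport (partialD i w) :=
  hw.fderiv_apply (𝕜 := ℝ) _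

theorem tsupport_partialD_subset (w : Eu N → ℝ) (i : Fin N) :
    tsupport (partialD i w) ⊆ tsupport w :=
  tsupport_fderiv_apply_subset ℝ _

theorem integrable_sq_of_continuous {w : Eu N → ℝ} (hw : Continuous w)
    (hwc : HasCompactSupport w) : Integrable fun x => w x ^ 2 :=
  (hw.memLp_of_hasCompactSupport hwc (p := 2)).integrable_sq

/-- Since `∂_i x_i = 1`, integration by parts gives `∫ w² = -2 ∫ x_i w ∂_i w`. Young's inequality
absorbs half of the left side, and `|x_i| ≤ R` where `w ≠ 0`. -/
theorem integral_sq_le_partialD {w : Eu N → ℝ} (hw : ContDiff ℝ 1 w) (hwc : HasCompactSupport w)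
    {R : ℝ} (hR : ∀ x, w x ≠ 0 → ‖x‖ ≤ R) (i : Fin N) :
    ∫ x, w x ^ 2 ≤ 4 * R ^ 2 * ∫ x, partialD i w x ^ 2 := by
  have hd := hw.differentiable (by simp)
  have hw2 : Integrable fun x => w x ^ 2 := integrable_sq_of_continuous hw.continuous hwc
  have hdw2 : Integrable fun x => partialD i w x ^ 2 :=
    integrable_sq_of_continuous (continuous_partialD hw i) (hasCompactSupport_partialD hwc i)
  have hg : ∀ x, fderiv ℝ (fun y => w y ^ 2) x (EuclideanSpace.single i 1) =
      2 * (w x * partialD i w x) := by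
    intro x
    rw [fderiv_fun_pow 2 (hd x)]
    simp [partialD]
    ring
  have hf : ∀ x, fderiv ℝ (fun y : Eu N => y i) x (EuclideanSpace.single i 1) = 1 := by
    intro x
    have : (fun y : Eu N => y i) = (EuclideanSpace.proj i : Eu N →L[ℝ] ℝ) := rfl
    rw [this, ContinuousLinearMap.fderiv]
    simp
  have hcs : HasCompactSupport fun x => w x ^ 2 := by
    have : (fun x => w x ^ 2) = fun x => w x * w x := funext fun x => sq _
    rw [this]
    exact hwc.mul_right
  have hint : Integrable fun x : Eu N => x i * (2 * (w x * partialD i w x)) := by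
    refine Continuous.integrable_of_hasCompactSupport ?_ ?_
    · have := continuous_partialD hw i
      have := hw.continuous
      fun_prop
    · exact ((hwc.mul_right (f' := partialD i w)).mul_left (f := fun _ => 2)).mul_left
  have parts := integral_mul_fderiv_eq_neg_fderiv_mul_of_integrable
    (μ := (volume : Measure (Eu N))) (f := fun y : Eu N => y i) (g := fun y => w y ^ 2)
    (v := EuclideanSpace.single i 1)
    (by simpa only [hf, one_mul] using hw2)
    (by simpa only [hg] using hint)
    (by
      refine Continuous.integrable_of_hasCompactSupport ?_ hcs.mul_left
      have := hw.continuous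
      fun_prop)
    (fun x _ => by fun_prop) (fun x _ => (hd x).pow 2)
  simp only [hf, hg, one_mul] at parts
  have hle : ∫ x, w x ^ 2 ≤ ∫ x, ((1 / 2) * w x ^ 2 + 2 * R ^ 2 * partialD i w x ^ 2) := by
    rw [← neg_neg (∫ x, w x ^ 2), ← parts, ← integral_neg]
    refine integral_mono hint.neg ((hw2.const_mul _).add (hdw2.const_mul _)) fun x => ?_
    by_cases hx : w x = 0
    · simp only [hx]
      have := sq_nonneg (R * partialD i w x)
      nlinarith
    · have h1 : |x i| ≤ R := (PiLp.norm_apply_le x i).trans (hR x hx)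
      have h2 : x i ^ 2 ≤ R ^ 2 := sq_le_sq' (by linarith [abs_le.1 h1]) (abs_le.1 h1).2
      simp only
      nlinarith [sq_nonneg (w x + 2 * x i * partialD i w x),
        mul_nonneg (sub_nonneg.2 h2) (sq_nonneg (partialD i w x))]
  rw [integral_add (hw2.const_mul _) (hdw2.const_mul _), integral_const_mul,
    integral_const_mul] at hle
  linarith

/-- The truncation at height `ε` of a function on `Ω`, extended by zero. -/
def truncate (Ω : Set (Eu N)) (ε : ℝ) (v : Eu N → ℝ) : Eu N → ℝ :=
  Ω.indicator fun x => ε * truncation (v x / ε)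

theorem truncate_of_mem {ε : ℝ} {v : Eu N → ℝ} {x : Eu N} (hx : x ∈ Ω) :
    truncate Ω ε v x = ε * truncation (v x / ε) := indicator_of_mem hx _

theorem truncate_of_notMem {ε : ℝ} {v : Eu N → ℝ} {x : Eu N} (hx : x ∉ Ω) :
    truncate Ω ε v x = 0 := indicator_of_notMem hx _

theorem abs_truncate_le {ε : ℝ} (hε : 0 < ε) {v : Eu N → ℝ} {x : Eu N} (hx : x ∈ Ω) :
    |truncate Ω ε v x| ≤ |v x| := by
  rw [truncate_of_mem hx, abs_mul, abs_of_pos hε]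
  calc ε * |truncation (v x / ε)| ≤ ε * |v x / ε| :=
        mul_le_mul_of_nonneg_left (abs_truncation_le _) hε.le
    _ = |v x| := by
        rw [abs_div, abs_of_pos hε]
        field_simp

theorem abs_truncate_sub_le {ε : ℝ} (hε : 0 < ε) {v : Eu N → ℝ} {x : Eu N} (hx : x ∈ Ω) :
    |truncate Ω ε v x - v x| ≤ 2 * ε := by
  have e : truncate Ω ε v x - v x = ε * (truncation (v x / ε) - v x / ε) := by
    rw [truncate_of_mem hx]
    field_simp
  rw [e, abs_mul, abs_of_pos hε, mul_comm]
  gcongr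
  exact abs_truncation_sub_le _

/-- A function on `Ω` with vanishing boundary values. -/
def VanishesOnFrontier (Ω : Set (Eu N)) (v : Eu N → ℝ) : Prop :=
  ∀ p ∈ frontier Ω, Tendsto v (𝓝[Ω] p) (𝓝 0)

/-- This is where the boundary values act: near the frontier `|v| < ε`, so the set cannot accumulate
there. It makes the truncation compactly supported in `Ω`, with no appeal to boundary regularity or
traces. -/
theorem isCompact_superlevel (hΩ : IsOpen Ω) (hb : Bornology.IsBounded Ω) {v : Eu N → ℝ}
    (hv : ContinuousOn v Ω) (h0 : VanishesOnFrontier Ω v) {ε : ℝ} (hε : 0 < ε) :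
    IsCompact {x | x ∈ Ω ∧ ε ≤ |v x|} := by
  refine Metric.isCompact_of_isClosed_isBounded (isClosed_of_closure_subset fun p hp => ?_)
    (hb.subset fun x hx => hx.1)
  have hpΩ : p ∈ closure Ω := closure_mono (fun x hx => hx.1) hp
  have hp' : ∃ᶠ x in 𝓝 p, x ∈ Ω ∧ ε ≤ |v x| := mem_closure_iff_frequently.1 hp
  by_cases h : p ∈ Ω
  · refine ⟨h, ?_⟩
    by_contra! hlt
    have := (hv.continuousAt (hΩ.mem_nhds h)).abs.eventually_lt continuousAt_const hlt
    obtain ⟨x, hx1, hx2⟩ := (hp'.and_eventually this).exists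
    exact absurd hx1.2 (not_le.2 hx2)
  · have hf : p ∈ frontier Ω := by
      rw [hΩ.frontier_eq]
      exact ⟨hpΩ, h⟩
    have h1 : ∀ᶠ x in 𝓝[Ω] p, |v x| < ε := by
      have := (h0 p hf).abs
      rw [abs_zero] at this
      exact this.eventually (gt_mem_nhds hε)
    rw [eventually_nhdsWithin_iff] at h1
    obtain ⟨x, hx1, hx2⟩ := (hp'.and_eventually h1).exists
    exact absurd hx1.2 (not_le.2 (hx2 hx1.1))

theorem tsupport_truncate_subset (hΩ : IsOpen Ω) (hb : Bornology.IsBounded Ω) {v : Eu N → ℝ}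
    (hv : ContinuousOn v Ω) (h0 : VanishesOnFrontier Ω v) {ε : ℝ} (hε : 0 < ε) :
    tsupport (truncate Ω ε v) ⊆ {x | x ∈ Ω ∧ ε ≤ |v x|} := by
  refine closure_minimal (fun x hx => ?_) (isCompact_superlevel hΩ hb hv h0 hε).isClosed
  have hxΩ : x ∈ Ω := by
    by_contra h
    exact hx (truncate_of_notMem h)
  refine ⟨hxΩ, ?_⟩
  by_contra! hlt
  refine hx ?_
  rw [truncate_of_mem hxΩ, truncation_eq_zero, mul_zero]
  rw [abs_div, abs_of_pos hε, div_le_one hε]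
  exact hlt.le

theorem hasCompactSupport_truncate (hΩ : IsOpen Ω) (hb : Bornology.IsBounded Ω) {v : Eu N → ℝ}
    (hv : ContinuousOn v Ω) (h0 : VanishesOnFrontier Ω v) {ε : ℝ} (hε : 0 < ε) :
    HasCompactSupport (truncate Ω ε v) :=
  (isCompact_superlevel hΩ hb hv h0 hε).of_isClosed_subset (isClosed_tsupport _)
    (tsupport_truncate_subset hΩ hb hv h0 hε)

theorem contDiff_truncate (hΩ : IsOpen Ω) (hb : Bornology.IsBounded Ω) {v : Eu N → ℝ}
    (hv : ContDiffOn ℝ 1 v Ω) (h0 : VanishesOnFrontier Ω v) {ε : ℝ} (hε : 0 < ε) :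
    ContDiff ℝ 1 (truncate Ω ε v) := by
  refine contDiff_iff_contDiffAt.2 fun x => ?_
  by_cases hx : x ∈ Ω
  · have h1 : ContDiffAt ℝ 1 (fun y => ε * truncation (v y / ε)) x :=
      contDiffAt_const.mul (contDiff_truncation.contDiffAt.comp x
        ((hv.contDiffAt (hΩ.mem_nhds hx)).div_const ε))
    refine h1.congr_of_eventuallyEq ?_
    filter_upwards [hΩ.mem_nhds hx] with y hy
    exact truncate_of_mem hy
  · have h1 : truncate Ω ε v =ᶠ[𝓝 x] 0 := notMem_tsupport_iff_eventuallyEq.1 fun h =>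
      hx (tsupport_truncate_subset hΩ hb hv.continuousOn h0 hε h).1
    exact contDiffAt_const.congr_of_eventuallyEq h1

theorem partialD_truncate (hΩ : IsOpen Ω) {v : Eu N → ℝ} (hv : ContDiffOn ℝ 1 v Ω) {ε : ℝ}
    (hε : 0 < ε) (i : Fin N) {x : Eu N} (hx : x ∈ Ω) :
    partialD i (truncate Ω ε v) x = truncationDeriv (v x / ε) * partialD i v x := by
  have h1 : truncate Ω ε v =ᶠ[𝓝 x] fun y => ε * truncation (v y / ε) := by
    filter_upwards [hΩ.mem_nhds hx] with y hy
    exact truncate_of_mem hy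
  have hd : DifferentiableAt ℝ v x :=
    (hv.contDiffAt (hΩ.mem_nhds hx)).differentiableAt (by simp)
  have h2 : HasFDerivAt (fun y => ε * truncation (ε⁻¹ * v y))
      (ε • truncationDeriv (ε⁻¹ * v x) • ε⁻¹ • fderiv ℝ v x) x :=
    ((hasDerivAt_truncation _).comp_hasFDerivAt x (hd.hasFDerivAt.const_mul ε⁻¹)).const_mul ε
  have h3 : (fun y => ε * truncation (v y / ε)) = fun y => ε * truncation (ε⁻¹ * v y) := by
    funext y
    rw [div_eq_inv_mul]
  simp only [partialD]
  rw [h1.fderiv_eq, h3, h2.fderiv, div_eq_inv_mul]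
  simp
  field_simp

/-- Dominated convergence along `ε = 1 / (n + 1)`, with `v²` as the majorant. -/
theorem integral_sq_le_of_truncate (hΩ : IsOpen Ω) {v : Eu N → ℝ} (hv : ContinuousOn v Ω)
    (hv2 : IntegrableOn (fun x => v x ^ 2) Ω) {B : ℝ}
    (h : ∀ ε > 0, ∫ x in Ω, truncate Ω ε v x ^ 2 ≤ B) : ∫ x in Ω, v x ^ 2 ≤ B := by
  have hε : ∀ n : ℕ, (0 : ℝ) < 1 / ((n : ℝ) + 1) := fun n => by positivity
  have hlim : Tendsto (fun n : ℕ => ∫ x in Ω, truncate Ω (1 / ((n : ℝ) + 1)) v x ^ 2) atTop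
      (𝓝 (∫ x in Ω, v x ^ 2)) := by
    refine tendsto_integral_of_dominated_convergence (fun x => v x ^ 2) (fun n => ?_) hv2
      (fun n => ?_) ?_
    · refine ContinuousOn.aestronglyMeasurable ?_ hΩ.measurableSet
      have h1 : ContinuousOn (fun x => (1 / ((n : ℝ) + 1) *
          truncation (v x / (1 / ((n : ℝ) + 1)))) ^ 2) Ω :=
        (continuousOn_const.mul (contDiff_truncation.continuous.comp_continuousOn
          (hv.div_const _))).pow 2
      exact h1.congr fun x hx => by rw [truncate_of_mem hx]
    · filter_upwards [ae_restrict_mem hΩ.measurableSet] with x hx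
      rw [Real.norm_of_nonneg (sq_nonneg _)]
      exact sq_le_sq.2 (abs_truncate_le (hε n) hx)
    · filter_upwards [ae_restrict_mem hΩ.measurableSet] with x hx
      refine Tendsto.pow ?_ 2
      refine tendsto_iff_norm_sub_tendsto_zero.2 (squeeze_zero (fun _ => norm_nonneg _)
        (fun n => abs_truncate_sub_le (hε n) hx) ?_)
      simpa using (tendsto_one_div_add_atTop_nhds_zero_nat (𝕜 := ℝ)).const_mul 2
  exact le_of_tendsto' hlim fun n => h _ (hε n)

theorem integral_truncate_sq_le (hN : 1 ≤ N) (hΩ : IsOpen Ω) {R : ℝ}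
    (hR : Ω ⊆ Metric.closedBall 0 R) {v : Eu N → ℝ} (hv : ContDiffOn ℝ 1 v Ω)
    (h0 : VanishesOnFrontier Ω v) {ε : ℝ} (hε : 0 < ε) :
    ∫ x, truncate Ω ε v x ^ 2 ≤ 4 * R ^ 2 * ∑ i, ∫ x, partialD i (truncate Ω ε v) x ^ 2 := by
  have hb : Bornology.IsBounded Ω := Metric.isBounded_closedBall.subset hR
  have hw := contDiff_truncate hΩ hb hv h0 hε
  have hwc := hasCompactSupport_truncate hΩ hb hv.continuousOn h0 hε
  refine (integral_sq_le_partialD hw hwc (R := R) (fun x hx => ?_) ⟨0, hN⟩).trans ?_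
  · have : x ∈ Ω := by
      by_contra h
      exact hx (truncate_of_notMem h)
    simpa using hR this
  · gcongr
    exact Finset.single_le_sum (f := fun i => ∫ x, partialD i (truncate Ω ε v) x ^ 2)
      (fun i _ => integral_nonneg fun x => sq_nonneg _) (Finset.mem_univ _)

theorem partialD_truncate_of_notMem (hΩ : IsOpen Ω) (hb : Bornology.IsBounded Ω) {v : Eu N → ℝ}
    (hv : ContDiffOn ℝ 1 v Ω) (h0 : VanishesOnFrontier Ω v) {ε : ℝ} (hε : 0 < ε) (i : Fin N)
    {x : Eu N} (hx : x ∉ Ω) : partialD i (truncate Ω ε v) x = 0 :=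
  image_eq_zero_of_notMem_tsupport fun h => hx
    (tsupport_truncate_subset hΩ hb hv.continuousOn h0 hε (tsupport_partialD_subset _ i h)).1

/-- The Poincaré inequality. -/
theorem integral_sq_le_integral_grad_sq (hN : 1 ≤ N) (hΩ : IsOpen Ω) {R : ℝ}
    (hR : Ω ⊆ Metric.closedBall 0 R) {v : Eu N → ℝ} (hv : ContDiffOn ℝ 1 v Ω)
    (h0 : VanishesOnFrontier Ω v) (hv2 : IntegrableOn (fun x => v x ^ 2) Ω)
    (hdv : ∀ i, IntegrableOn (fun x => partialD i v x ^ 2) Ω) :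
    ∫ x in Ω, v x ^ 2 ≤ 4 * R ^ 2 * ∑ i, ∫ x in Ω, partialD i v x ^ 2 := by
  have hb : Bornology.IsBounded Ω := Metric.isBounded_closedBall.subset hR
  refine integral_sq_le_of_truncate hΩ hv.continuousOn hv2 fun ε hε => ?_
  rw [setIntegral_eq_integral_of_forall_compl_eq_zero
    fun x hx => by rw [truncate_of_notMem hx]; simp]
  refine (integral_truncate_sq_le hN hΩ hR hv h0 hε).trans ?_
  gcongr with i _
  rw [← setIntegral_eq_integral_of_forall_compl_eq_zero (s := Ω)
    (f := fun x => partialD i (truncate Ω ε v) x ^ 2)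
    fun x hx => by rw [partialD_truncate_of_notMem hΩ hb hv h0 hε i hx]; simp]
  refine setIntegral_mono_on ?_ (hdv i) hΩ.measurableSet fun x hx => ?_
  · exact (integrable_sq_of_continuous (continuous_partialD (contDiff_truncate hΩ hb hv h0 hε) i)
      (hasCompactSupport_partialD
        (hasCompactSupport_truncate hΩ hb hv.continuousOn h0 hε) i)).integrableOn
  · rw [partialD_truncate hΩ hv hε i hx, mul_pow]
    refine mul_le_of_le_one_left (sq_nonneg _) (pow_le_one₀ (truncationDeriv_nonneg _)
      (truncationDeriv_le_one _))

/-- The `L²`-norm of a function with vanishing boundary values is controlled by its Laplacian. -/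
theorem integral_sq_le_integral_lapl_sq (hN : 1 ≤ N) (hΩ : IsOpen Ω) {R : ℝ}
    (hR : Ω ⊆ Metric.closedBall 0 R) {v : Eu N → ℝ} (hv : ContDiffOn ℝ (2 : ℕ) v Ω)
    (h0 : VanishesOnFrontier Ω v) (hv2 : IntegrableOn (fun x => v x ^ 2) Ω)
    (hdv : IntegrableOn (fun x => lapl v x ^ 2) Ω) :
    ∫ x in Ω, v x ^ 2 ≤ 16 * R ^ 4 * ∫ x in Ω, lapl v x ^ 2 := by
  have hb : Bornology.IsBounded Ω := Metric.isBounded_closedBall.subset hR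
  have hv1 : ContDiffOn ℝ 1 v Ω := hv.of_le (by norm_num)
  refine integral_sq_le_of_truncate hΩ hv.continuousOn hv2 fun ε hε => ?_
  have hpv : ∀ i, ContDiffOn ℝ (1 : ℕ) (partialD i v) Ω := fun i => contDiffOn_partialD hΩ hv i
  have hppv : ∀ i, ContinuousOn (partialD i (partialD i v)) Ω := fun i =>
    (contDiffOn_partialD hΩ (n := 0) (hpv i) i).continuousOn
  set w := truncate Ω ε v with hwdef
  have hw : ContDiff ℝ 1 w := contDiff_truncate hΩ hb hv1 h0 hε
  have hwc : HasCompactSupport w := hasCompactSupport_truncate hΩ hb hv.continuousOn h0 hε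
  have hws : tsupport w ⊆ Ω := fun x hx =>
    (tsupport_truncate_subset hΩ hb hv.continuousOn h0 hε hx).1
  have hdw : ∀ i, Integrable fun x => partialD i w x * partialD i v x := fun i =>
    integrable_mul_of_tsupport_subset hΩ (continuous_partialD hw i)
      (hasCompactSupport_partialD hwc i) ((tsupport_partialD_subset w i).trans hws)
      (hpv i).continuousOn
  have hwd : ∀ i, Integrable fun x => w x * partialD i (partialD i v) x := fun i =>
    integrable_mul_of_tsupport_subset hΩ hw.continuous hwc hws (hppv i)
  have hw2 : Integrable fun x => w x ^ 2 := integrable_sq_of_continuous hw.continuous hwc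
  have parts : ∀ i, ∫ x, w x * partialD i (partialD i v) x =
      - ∫ x, partialD i w x * partialD i v x := fun i =>
    integral_mul_fderiv_eq_neg_fderiv_mul_of_integrable (hdw i) (hwd i)
      (integrable_mul_of_tsupport_subset hΩ hw.continuous hwc hws (hpv i).continuousOn)
      (fun x _ => hw.differentiable (by simp) x)
      (fun x hx => differentiableAt_of_contDiffOn hΩ (n := 0) (hpv i) (hws hx))
  -- In `Ω`, `∇w = θ ∇v` with `0 ≤ θ ≤ 1`, whence `|∇w|² ≤ ∇w · ∇v`. Integrating by parts puts the
  -- second derivative on `v`, and no integrability of `∇v` up to the boundary is required.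
  have h1 : ∑ i, ∫ x, partialD i w x ^ 2 ≤ - ∫ x, w x * lapl v x := by
    have e : ∫ x, w x * lapl v x = ∑ i, ∫ x, w x * partialD i (partialD i v) x := by
      rw [← integral_finsetSum _ fun i _ => hwd i]
      simp only [lapl, Finset.mul_sum]
    rw [e, ← Finset.sum_neg_distrib]
    refine Finset.sum_le_sum fun i _ => ?_
    rw [parts, neg_neg]
    refine integral_mono (integrable_sq_of_continuous (continuous_partialD hw i)
      (hasCompactSupport_partialD hwc i)) (hdw i) fun x => ?_
    by_cases hx : x ∈ Ω
    · simp only [hwdef]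
      rw [partialD_truncate hΩ hv1 hε i hx]
      have h2 := truncationDeriv_nonneg (v x / ε)
      have h3 := truncationDeriv_le_one (v x / ε)
      nlinarith [mul_nonneg (mul_nonneg h2 (sub_nonneg.2 h3)) (sq_nonneg (partialD i v x))]
    · simp only [hwdef]
      rw [partialD_truncate_of_notMem hΩ hb hv1 h0 hε i hx]
      simp
  have h2 := integral_truncate_sq_le hN hΩ hR hv1 h0 hε
  have hcompl : ∀ x, x ∉ Ω → w x = 0 := fun x hx => truncate_of_notMem hx
  have e1 : ∫ x in Ω, w x ^ 2 = ∫ x, w x ^ 2 :=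
    setIntegral_eq_integral_of_forall_compl_eq_zero fun x hx => by rw [hcompl x hx]; simp
  have e2 : ∫ x in Ω, w x * lapl v x = ∫ x, w x * lapl v x :=
    setIntegral_eq_integral_of_forall_compl_eq_zero fun x hx => by rw [hcompl x hx]; simp
  have hwl : Integrable fun x => w x * lapl v x :=
    integrable_mul_of_tsupport_subset hΩ hw.continuous hwc hws
      (contDiffOn_lapl hΩ (n := 0) hv).continuousOn
  have h3 : 4 * R ^ 2 * (- ∫ x in Ω, w x * lapl v x) ≤
      (1 / 2) * (∫ x in Ω, w x ^ 2) + 8 * R ^ 4 * ∫ x in Ω, lapl v x ^ 2 := by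
    rw [← integral_const_mul, ← integral_const_mul, ← integral_add
      (hw2.integrableOn.const_mul _) (hdv.const_mul _), ← integral_neg, ← integral_const_mul]
    refine integral_mono (hwl.integrableOn.neg.const_mul _)
      ((hw2.integrableOn.const_mul _).add (hdv.const_mul _)) fun x => ?_
    simp only
    -- The difference of the two sides is half of this square; the term with `1 / 2` is then
    -- absorbed into the left side.
    nlinarith [sq_nonneg (w x + 4 * R ^ 2 * lapl v x)]
  rw [← hwdef] at h2
  have h4 : ∫ x, w x ^ 2 ≤ 4 * R ^ 2 * (- ∫ x, w x * lapl v x) :=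
    h2.trans (by gcongr)
  rw [e2, e1] at h3
  rw [e1]
  linarith

/-! ### Coercivity of the energy -/

theorem IsNavierCm.vanishesOnFrontier (hΩ : IsOpen Ω) {u : Eu N → ℝ} (hu : IsNavierCm m Ω u)
    {j : ℕ} (hj : 2 * j < m) : VanishesOnFrontier Ω (lapl^[j] u) := by
  intro p hp
  refine (hu.2 j hj p hp).congr' ?_
  filter_upwards [self_mem_nhdsWithin] with x hx
  exact laplacian_iterate_eqOn_lapl hΩ (hu.1.1.of_le (by norm_cast; omega)) hx

theorem integrableOn_sq_of_ae_eq {g : L2 Ω} {v : Eu N → ℝ} (h : g =ᵐ[volume.restrict Ω] v) :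
    IntegrableOn (fun x => v x ^ 2) Ω :=
  (integrable_sq g).congr (h.mono fun x hx => by simp only [hx])

theorem integral_sq_of_ae_eq {g : L2 Ω} {v : Eu N → ℝ} (h : g =ᵐ[volume.restrict Ω] v) :
    ∫ x in Ω, v x ^ 2 = ‖g‖ ^ 2 := by
  rw [← integral_sq_eq_norm_sq]
  exact integral_congr_ae (h.mono fun x hx => by simp only [hx])

/-- Each passage from `Δ^k u` to `Δ^{k+1} u` is one application of the Laplacian estimate,
legitimate because `Δ^k u` vanishes on the frontier as long as `2k < m`. -/
theorem norm_sq_le_of_represents (hN : 1 ≤ N) (hΩ : IsOpen Ω) {R : ℝ}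
    (hR : Ω ⊆ Metric.closedBall 0 R) {u : Eu N → ℝ} (hu : IsNavierCm m Ω u)
    {f : Sobolev N m Ω} (hf : Represents u f) {k : ℕ} (hk : 2 * k ≤ m) :
    ‖weakD f 0‖ ^ 2 ≤ (16 * R ^ 4) ^ k * ‖lapPow f k 0‖ ^ 2 := by
  induction k with
  | zero => simp [lapPow]
  | succ k ih =>
    refine (ih (by omega)).trans ?_
    have h1 := lapPow_zero_ae_eq hΩ hu.1.1 hf (k := k) (by omega)
    have h2 := lapPow_zero_ae_eq hΩ hu.1.1 hf (k := k + 1) hk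
    rw [Function.iterate_succ_apply'] at h2
    have h3 := integral_sq_le_integral_lapl_sq hN hΩ hR
      (contDiffOn_lapl_iterate hΩ (hu.1.1.of_le (by norm_cast; omega)))
      (hu.vanishesOnFrontier hΩ (j := k) (by omega)) (integrableOn_sq_of_ae_eq h1)
      (integrableOn_sq_of_ae_eq h2)
    rw [integral_sq_of_ae_eq h1, integral_sq_of_ae_eq h2] at h3
    calc _ ≤ (16 * R ^ 4) ^ k * (16 * R ^ 4 * ‖lapPow f (k + 1) 0‖ ^ 2) := by gcongr
      _ = _ := by ring

/-- The energy controls the `L²`-norm on `V^m(Ω)`. -/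
theorem exists_norm_sq_le_integral_gradSq (hN : 1 ≤ N) (hΩ : IsOpen Ω)
    (hb : Bornology.IsBounded Ω) (bc : BoundaryCondition) (m : ℕ) :
    ∃ C, 0 ≤ C ∧ ∀ f ∈ V bc m Ω, ‖weakD f 0‖ ^ 2 ≤ C * ∫ x in Ω, gradSq f x := by
  obtain ⟨R, hR⟩ := hb.subset_closedBall 0
  refine ⟨(16 * R ^ 4) ^ (m / 2) * if Even m then 1 else 4 * R ^ 2, ?_, fun f hf => ?_⟩
  · split_ifs <;> positivity
  -- Both sides are continuous in the Sobolev norm, so the inequality passes from the classical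
  -- functions to their closure.
  have hcl : IsClosed {f : Sobolev N m Ω | ‖weakD f 0‖ ^ 2 ≤
      ((16 * R ^ 4) ^ (m / 2) * if Even m then 1 else 4 * R ^ 2) * ∫ x in Ω, gradSq f x} :=
    isClosed_le ((continuous_lapPow 0 0).norm.pow 2)
      (continuous_const.mul continuous_integral_gradSq)
  refine closure_minimal ?_ hcl hf
  rintro f ⟨u, hu, hf⟩
  have hu' := hu.isNavierCm hΩ
  have h1 := norm_sq_le_of_represents hN hΩ hR hu' hf (Nat.mul_div_le m 2)
  rw [mem_ofPred_eq, integral_gradSq]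
  by_cases h : Even m
  · simpa only [if_pos h, mul_one] using h1
  · have hm := two_mul_half_add_one_le h
    simp only [if_neg h]
    refine h1.trans ?_
    rw [mul_assoc]
    gcongr
    have h2 := lapPow_zero_ae_eq hΩ hu'.1.1 hf (k := m / 2) (by omega)
    have h3 := fun i => lapPow_single_ae_eq hΩ hu'.1.1 hf (k := m / 2) hm i
    -- For odd `m` one first-order Poincaré step remains; `Δ^{(m-1)/2} u` still vanishes on the
    -- frontier because `m - 1 < m`.
    have h4 := integral_sq_le_integral_grad_sq hN hΩ hR
      (contDiffOn_lapl_iterate (n := 1) hΩ (hu'.1.1.of_le (by norm_cast; omega)))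
      (hu'.vanishesOnFrontier hΩ (j := m / 2) (by omega)) (integrableOn_sq_of_ae_eq h2)
      (fun i => integrableOn_sq_of_ae_eq (h3 i))
    simpa only [integral_sq_of_ae_eq h2, fun i => integral_sq_of_ae_eq (h3 i)] using h4

/-! ### Radial profiles -/

/-- Smooth functions `S_j` on the real line, vanishing on `[ρ, ∞)`, with `S_{j+1}' = - S_j / 2`. -/
def profile (ρ : ℝ) : ℕ → ℝ → ℝ
  | 0 => fun s => Real.smoothTransition (1 - s / ρ)
  | j + 1 => fun s => (1 / 2) * ∫ t in s..ρ, profile ρ j t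

theorem continuous_profile (ρ : ℝ) (j : ℕ) : Continuous (profile ρ j) := by
  induction j with
  | zero => exact Real.smoothTransition.continuous.comp (by fun_prop)
  | succ j ih =>
    have h : ∀ s, HasDerivAt (fun s => ∫ t in s..ρ, profile ρ j t) (-profile ρ j s) s := fun s =>
      intervalIntegral.integral_hasDerivAt_left (ih.intervalIntegrable _ _)
        (ih.stronglyMeasurableAtFilter _ _) ih.continuousAt
    exact continuous_const.mul (continuous_iff_continuousAt.2 fun s => (h s).continuousAt)

theorem hasDerivAt_profile_succ (ρ : ℝ) (j : ℕ) (s : ℝ) :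
    HasDerivAt (profile ρ (j + 1)) (-(1 / 2) * profile ρ j s) s := by
  have ih := continuous_profile ρ j
  have h : HasDerivAt (fun s => ∫ t in s..ρ, profile ρ j t) (-profile ρ j s) s :=
    intervalIntegral.integral_hasDerivAt_left (ih.intervalIntegrable _ _)
      (ih.stronglyMeasurableAtFilter _ _) ih.continuousAt
  have := h.const_mul (1 / 2)
  rwa [mul_neg, ← neg_mul] at this

theorem deriv_profile_succ (ρ : ℝ) (j : ℕ) :
    deriv (profile ρ (j + 1)) = fun s => -(1 / 2) * profile ρ j s :=
  funext fun s => (hasDerivAt_profile_succ ρ j s).deriv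

theorem contDiff_profile (ρ : ℝ) (j : ℕ) : ContDiff ℝ ∞ (profile ρ j) := by
  induction j with
  | zero => exact Real.smoothTransition.contDiff.comp (by fun_prop)
  | succ j ih =>
    refine contDiff_infty_iff_deriv.2
      ⟨fun s => (hasDerivAt_profile_succ ρ j s).differentiableAt, ?_⟩
    rw [deriv_profile_succ]
    exact contDiff_const.mul ih

theorem profile_eq_zero {ρ : ℝ} (hρ : 0 < ρ) (j : ℕ) {s : ℝ} (hs : ρ ≤ s) :
    profile ρ j s = 0 := by
  induction j generalizing s with
  | zero =>
    refine Real.smoothTransition.zero_of_nonpos ?_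
    have : 1 ≤ s / ρ := (one_le_div hρ).2 hs
    linarith
  | succ j ih =>
    have : ∫ t in s..ρ, profile ρ j t = ∫ _t in s..ρ, (0 : ℝ) := by
      refine intervalIntegral.integral_congr fun t ht => ?_
      rw [uIcc_of_ge hs] at ht
      exact ih ht.1
    simp [profile, this]

/-- The Laplacian on functions of `|x|²`. -/
def radialLapl (N : ℕ) (Z : ℝ → ℝ) : ℝ → ℝ :=
  fun s => 4 * s * deriv (deriv Z) s + 2 * N * deriv Z s

theorem contDiff_deriv {Z : ℝ → ℝ} (h : ContDiff ℝ ∞ Z) : ContDiff ℝ ∞ (deriv Z) :=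
  (contDiff_infty_iff_deriv.1 h).2

theorem hasDerivAt_of_contDiff {Z : ℝ → ℝ} (h : ContDiff ℝ ∞ Z) (s : ℝ) :
    HasDerivAt Z (deriv Z s) s :=
  ((contDiff_infty_iff_deriv.1 h).1 s).hasDerivAt

theorem contDiff_radialLapl {Z : ℝ → ℝ} (h : ContDiff ℝ ∞ Z) : ContDiff ℝ ∞ (radialLapl N Z) := by
  have h1 := contDiff_deriv h
  have h2 := contDiff_deriv h1
  unfold radialLapl
  fun_prop

theorem contDiff_radialLapl_iterate {Z : ℝ → ℝ} (h : ContDiff ℝ ∞ Z) (k : ℕ) :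
    ContDiff ℝ ∞ ((radialLapl N)^[k] Z) := by
  induction k with
  | zero => exact h
  | succ k ih =>
    rw [Function.iterate_succ_apply']
    exact contDiff_radialLapl ih

/-- The commutator of the Laplacian with the Euler operator. -/
theorem radialLapl_euler {Z : ℝ → ℝ} (h : ContDiff ℝ ∞ Z) (a : ℝ) :
    radialLapl N (fun s => a * Z s + 2 * s * deriv Z s) =
      fun s => (a + 2) * radialLapl N Z s + 2 * s * deriv (radialLapl N Z) s := by
  have h1 := contDiff_deriv h
  have h2 := contDiff_deriv h1
  have d0 := hasDerivAt_of_contDiff h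
  have d1 := hasDerivAt_of_contDiff h1
  have d2 := hasDerivAt_of_contDiff h2
  have did : ∀ s : ℝ, HasDerivAt (fun s : ℝ => 2 * s) 2 s := fun s => by
    simpa using (hasDerivAt_id s).const_mul (2 : ℝ)
  have did4 : ∀ s : ℝ, HasDerivAt (fun s : ℝ => 4 * s) 4 s := fun s => by
    simpa using (hasDerivAt_id s).const_mul (4 : ℝ)
  have e1 : deriv (fun s => a * Z s + 2 * s * deriv Z s) =
      fun s => (a + 2) * deriv Z s + 2 * s * deriv (deriv Z) s := funext fun s => by
    refine Eq.trans (((d0 s).const_mul a).add ((did s).mul (d1 s))).deriv ?_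
    ring
  have e2 : deriv (fun s => (a + 2) * deriv Z s + 2 * s * deriv (deriv Z) s) =
      fun s => (a + 4) * deriv (deriv Z) s + 2 * s * deriv (deriv (deriv Z)) s :=
    funext fun s => by
      refine Eq.trans (((d1 s).const_mul (a + 2)).add ((did s).mul (d2 s))).deriv ?_
      ring
  have e3 : deriv (radialLapl N Z) = fun s =>
      (4 + 2 * N) * deriv (deriv Z) s + 4 * s * deriv (deriv (deriv Z)) s := funext fun s => by
    unfold radialLapl
    refine Eq.trans (((did4 s).mul (d2 s)).add ((d1 s).const_mul (2 * (N : ℝ)))).deriv ?_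
    ring
  funext s
  rw [e3]
  simp only [radialLapl, e1, e2]
  ring

theorem radialLapl_iterate_euler {Z : ℝ → ℝ} (h : ContDiff ℝ ∞ Z) (a : ℝ) (k : ℕ) :
    (radialLapl N)^[k] (fun s => a * Z s + 2 * s * deriv Z s) =
      fun s => (a + 2 * k) * (radialLapl N)^[k] Z s +
        2 * s * deriv ((radialLapl N)^[k] Z) s := by
  induction k with
  | zero => simp
  | succ k ih =>
    simp only [Function.iterate_succ_apply']
    rw [ih, radialLapl_euler (contDiff_radialLapl_iterate h k)]
    funext s
    push_cast
    ring

theorem radialLapl_neg (Z : ℝ → ℝ) : radialLapl N (-Z) = -radialLapl N Z := by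
  funext s
  have e : deriv (-Z) = -deriv Z := funext fun s => deriv.neg
  have e' : deriv (-deriv Z) = -deriv (deriv Z) := funext fun s => deriv.neg
  simp only [radialLapl, Pi.neg_apply, e, e']
  ring

theorem radialLapl_iterate_neg (Z : ℝ → ℝ) (k : ℕ) :
    (radialLapl N)^[k] (-Z) = -(radialLapl N)^[k] Z := by
  induction k with
  | zero => rfl
  | succ k ih => rw [Function.iterate_succ_apply', ih, radialLapl_neg, Function.iterate_succ_apply']

/-- The relation `S_{j+1}' = -S_j / 2` is designed for this: `Δ` of one profile is `-(N + x · ∇)` of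
the preceding one, `2 s d/ds` being the Euler operator in the variable `s = |x|²`. -/
theorem radialLapl_profile_succ (N : ℕ) (ρ : ℝ) (j : ℕ) : radialLapl N (profile ρ (j + 1)) =
    -fun s => (N : ℝ) * profile ρ j s + 2 * s * deriv (profile ρ j) s := by
  funext s
  have e : deriv (fun s => -(1 / 2) * profile ρ j s) =
      fun s => -(1 / 2) * deriv (profile ρ j) s :=
    funext fun s => ((hasDerivAt_of_contDiff (contDiff_profile ρ j) s).const_mul _).deriv
  simp only [radialLapl, deriv_profile_succ, e, Pi.neg_apply]
  ring

/-- The profile of `Δ^j S_j(|x|²)`. -/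
def laplProfile (N : ℕ) (ρ : ℝ) (j : ℕ) : ℝ → ℝ := (radialLapl N)^[j] (profile ρ j)

theorem contDiff_laplProfile (N : ℕ) (ρ : ℝ) (j : ℕ) : ContDiff ℝ ∞ (laplProfile N ρ j) :=
  contDiff_radialLapl_iterate (contDiff_profile ρ j) j

/-- Moving `Δ^j` past `N + x · ∇` raises the constant by `2j`, which matches the homogeneity `t ^
(-(N + 2j))` of the kernel. -/
theorem laplProfile_succ (N : ℕ) (ρ : ℝ) (j : ℕ) (s : ℝ) : laplProfile N ρ (j + 1) s =
    -((N + 2 * j) * laplProfile N ρ j s + 2 * s * deriv (laplProfile N ρ j) s) := by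
  rw [laplProfile, Function.iterate_succ_apply, radialLapl_profile_succ, radialLapl_iterate_neg,
    radialLapl_iterate_euler (contDiff_profile ρ j)]
  rfl

theorem radialLapl_eqOn_zero {Z : ℝ → ℝ} {ρ : ℝ} (h : ∀ s ∈ Ioi ρ, Z s = 0) :
    ∀ s ∈ Ioi ρ, radialLapl N Z s = 0 := by
  have key : ∀ {W : ℝ → ℝ}, (∀ s ∈ Ioi ρ, W s = 0) → ∀ s ∈ Ioi ρ, deriv W s = 0 := by
    intro W hW s hs
    have : W =ᶠ[𝓝 s] fun _ => 0 := by
      filter_upwards [isOpen_Ioi.mem_nhds hs] with y hy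
      exact hW y hy
    rw [this.deriv_eq, deriv_const]
  intro s hs
  rw [radialLapl, key (key h) s hs, key h s hs]
  simp

theorem laplProfile_eq_zero {ρ : ℝ} (hρ : 0 < ρ) (j : ℕ) {s : ℝ} (hs : ρ < s) :
    laplProfile N ρ j s = 0 := by
  have : ∀ k, ∀ s ∈ Ioi ρ, (radialLapl N)^[k] (profile ρ j) s = 0 := by
    intro k
    induction k with
    | zero => exact fun s hs => profile_eq_zero hρ j (le_of_lt hs)
    | succ k ih =>
      rw [Function.iterate_succ_apply']
      exact radialLapl_eqOn_zero ih
  exact this j s hs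

/-- Compactness of `[0, ρ]` suffices, since the profile vanishes beyond `ρ` and only nonnegative
arguments `|x - x₀|² / t²` occur. -/
theorem exists_abs_laplProfile_le (N : ℕ) {ρ : ℝ} (hρ : 0 < ρ) (j : ℕ) :
    ∃ M, 0 ≤ M ∧ ∀ s, 0 ≤ s → |laplProfile N ρ j s| ≤ M := by
  obtain ⟨M, hM⟩ := isCompact_Icc.exists_bound_of_continuousOn (s := Icc 0 ρ)
    (contDiff_laplProfile N ρ j).continuous.continuousOn
  refine ⟨max M 0, le_max_right _ _, fun s hs => ?_⟩
  rcases le_or_gt s ρ with h | h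
  · exact (hM s ⟨hs, h⟩).trans (le_max_left _ _)
  · rw [laplProfile_eq_zero hρ j h, abs_zero]
    exact le_max_right _ _

/-! ### Radial functions in `ℝ^N` -/

/-- The function `x ↦ Z(c |x - x₀|²)`. -/
def radial (x₀ : Eu N) (c : ℝ) (Z : ℝ → ℝ) : Eu N → ℝ := fun x => Z (c * ‖x - x₀‖ ^ 2)

theorem contDiff_radial (x₀ : Eu N) (c : ℝ) {Z : ℝ → ℝ} (h : ContDiff ℝ ∞ Z) :
    ContDiff ℝ ∞ (radial x₀ c Z) :=
  h.comp (contDiff_const.mul ((contDiff_id.sub contDiff_const).norm_sq ℝ))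

theorem partialD_radial (x₀ : Eu N) (c : ℝ) {Z : ℝ → ℝ} (h : ContDiff ℝ ∞ Z) (i : Fin N) :
    partialD i (radial x₀ c Z) =
      fun x => 2 * c * ((x i - x₀ i) * radial x₀ c (deriv Z) x) := by
  funext x
  have h1 : HasFDerivAt (fun x : Eu N => c * ‖x - x₀‖ ^ 2)
      (c • (2 • (innerSL ℝ (x - x₀)))) x := by
    have := (hasStrictFDerivAt_norm_sq (x - x₀)).hasFDerivAt.comp x
      ((hasFDerivAt_id x).sub_const x₀)
    exact this.const_mul c
  have h2 := (hasDerivAt_of_contDiff h (c * ‖x - x₀‖ ^ 2)).comp_hasFDerivAt x h1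
  have h3 : radial x₀ c Z = Z ∘ fun x => c * ‖x - x₀‖ ^ 2 := rfl
  rw [partialD, h3, h2.fderiv]
  simp [radial, EuclideanSpace.inner_single_right]
  ring

theorem partialD_coord_mul (x₀ : Eu N) {v : Eu N → ℝ} {x : Eu N} (hv : DifferentiableAt ℝ v x)
    (i : Fin N) : partialD i (fun y => (y i - x₀ i) * v y) x =
      (x i - x₀ i) * partialD i v x + v x := by
  have h1 : HasFDerivAt (fun y : Eu N => y i - x₀ i) (EuclideanSpace.proj i : Eu N →L[ℝ] ℝ) x :=
    (EuclideanSpace.proj i : Eu N →L[ℝ] ℝ).hasFDerivAt.sub_const _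
  rw [partialD_mul h1.differentiableAt hv]
  simp [partialD, h1.fderiv]

theorem lapl_radial (x₀ : Eu N) (c : ℝ) {Z : ℝ → ℝ} (h : ContDiff ℝ ∞ Z) :
    lapl (radial x₀ c Z) = fun x => c * radial x₀ c (radialLapl N Z) x := by
  funext x
  have h1 := contDiff_deriv h
  have e : ∀ i : Fin N, partialD i (partialD i (radial x₀ c Z)) x = 4 * c ^ 2 *
      radial x₀ c (deriv (deriv Z)) x * (x i - x₀ i) ^ 2 + 2 * c * radial x₀ c (deriv Z) x := by
    intro i
    rw [partialD_radial x₀ c h, partialD_const_mul]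
    simp only
    rw [partialD_coord_mul x₀ ((contDiff_radial x₀ c h1).differentiable (by simp) x),
      partialD_radial x₀ c h1]
    ring
  have hn : ‖x - x₀‖ ^ 2 = ∑ i, (x i - x₀ i) ^ 2 := by
    rw [EuclideanSpace.norm_sq_eq]
    simp
  simp only [lapl, e]
  rw [Finset.sum_add_distrib, ← Finset.mul_sum, ← hn]
  simp only [radial, radialLapl, Finset.sum_const, Finset.card_univ, Fintype.card_fin,
    nsmul_eq_mul]
  ring

theorem lapl_iterate_radial (x₀ : Eu N) (c : ℝ) {Z : ℝ → ℝ} (h : ContDiff ℝ ∞ Z) (k : ℕ) :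
    lapl^[k] (radial x₀ c Z) = fun x => c ^ k * radial x₀ c ((radialLapl N)^[k] Z) x := by
  induction k with
  | zero => simp
  | succ k ih =>
    rw [Function.iterate_succ_apply', ih, lapl_const_mul,
      lapl_radial x₀ c (contDiff_radialLapl_iterate h k), Function.iterate_succ_apply']
    funext x
    ring

/-! ### The kernels -/

/-- The rescaled bump `t^{-N} S_j(|x - x₀|² / t²)`. -/
def bump (x₀ : Eu N) (ρ : ℝ) (j : ℕ) (t : ℝ) : Eu N → ℝ :=
  fun x => (t ^ N)⁻¹ * radial x₀ ((t ^ 2)⁻¹) (profile ρ j) x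

/-- The kernel `Δ^j (t^{-N} S_j(|x - x₀|² / t²))`. -/
def kernel (x₀ : Eu N) (ρ : ℝ) (j : ℕ) (t : ℝ) : Eu N → ℝ :=
  fun x => (t ^ (N + 2 * j))⁻¹ * laplProfile N ρ j ((t ^ 2)⁻¹ * ‖x - x₀‖ ^ 2)

theorem lapl_iterate_const_mul (c : ℝ) (u : Eu N → ℝ) (k : ℕ) :
    lapl^[k] (fun x => c * u x) = fun x => c * lapl^[k] u x := by
  induction k with
  | zero => rfl
  | succ k ih => rw [Function.iterate_succ_apply', ih, lapl_const_mul, Function.iterate_succ_apply']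

theorem lapl_iterate_bump (x₀ : Eu N) (ρ : ℝ) (j : ℕ) (t : ℝ) :
    lapl^[j] (bump x₀ ρ j t) = kernel x₀ ρ j t := by
  unfold bump
  rw [lapl_iterate_const_mul, lapl_iterate_radial x₀ _ (contDiff_profile ρ j)]
  funext x
  simp only [kernel, radial, laplProfile]
  rw [← mul_assoc, pow_add, pow_mul, mul_inv, inv_pow]

/-- Differentiating `t ^ (-(N + 2j)) F(|x - x₀|²/t²)` in `t` produces `-((N + 2j) F + 2 s F') / t`,
and by `laplProfile_succ` the bracket is the next profile up to sign. -/
theorem hasDerivAt_kernel (x₀ : Eu N) (ρ : ℝ) (j : ℕ) {t : ℝ} (ht : 0 < t) (x : Eu N) :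
    HasDerivAt (fun t => kernel x₀ ρ j t x) (t * kernel x₀ ρ (j + 1) t x) t := by
  have h1 : HasDerivAt (fun t : ℝ => (t ^ (N + 2 * j))⁻¹)
      (-((N + 2 * j : ℕ) * t ^ (N + 2 * j - 1)) / (t ^ (N + 2 * j)) ^ 2) t :=
    (hasDerivAt_pow _ t).inv (by positivity)
  have h2 : HasDerivAt (fun t : ℝ => (t ^ 2)⁻¹ * ‖x - x₀‖ ^ 2)
      (-((2 : ℕ) * t ^ (2 - 1)) / (t ^ 2) ^ 2 * ‖x - x₀‖ ^ 2) t :=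
    ((hasDerivAt_pow 2 t).inv (by positivity)).mul_const _
  have h3 := (hasDerivAt_of_contDiff (contDiff_laplProfile N ρ j)
    ((t ^ 2)⁻¹ * ‖x - x₀‖ ^ 2)).comp t h2
  refine (h1.mul h3).congr_deriv ?_
  simp only [kernel, laplProfile_succ, Function.comp]
  generalize laplProfile N ρ j ((t ^ 2)⁻¹ * ‖x - x₀‖ ^ 2) = a
  generalize deriv (laplProfile N ρ j) ((t ^ 2)⁻¹ * ‖x - x₀‖ ^ 2) = b
  -- The truncated subtraction forces the case `N + 2 * j = 0` apart; there the prefactor is zero.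
  have e : ((N + 2 * j : ℕ) : ℝ) * t ^ (N + 2 * j - 1) =
      (N + 2 * j : ℕ) * t ^ (N + 2 * j) / t := by
    rcases Nat.eq_zero_or_pos (N + 2 * j) with h | h
    · rw [h]
      simp
    · rw [mul_div_assoc]
      congr 1
      rw [eq_div_iff ht.ne', ← pow_succ, Nat.sub_add_cancel h]
  rw [e, show N + 2 * (j + 1) = N + 2 * j + 2 by ring, pow_add]
  push_cast
  have ht' : t ^ (N + 2 * j) ≠ 0 := by positivity
  generalize t ^ (N + 2 * j) = T at *
  field_simp
  ring

theorem exists_abs_kernel_le (x₀ : Eu N) {ρ : ℝ} (hρ : 0 < ρ) (j : ℕ) :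
    ∃ M, 0 ≤ M ∧ ∀ t > 0, ∀ x, |kernel x₀ ρ j t x| ≤ (t ^ (N + 2 * j))⁻¹ * M := by
  obtain ⟨M, hM0, hM⟩ := exists_abs_laplProfile_le N hρ j
  refine ⟨M, hM0, fun t ht x => ?_⟩
  rw [kernel, abs_mul, abs_of_pos (by positivity : 0 < (t ^ (N + 2 * j))⁻¹)]
  gcongr
  exact hM _ (by positivity)

theorem continuous_kernel (x₀ : Eu N) (ρ : ℝ) (j : ℕ) (t : ℝ) : Continuous (kernel x₀ ρ j t) := by
  have := (contDiff_laplProfile N ρ j).continuous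
  unfold kernel
  fun_prop

/-! ### Averages against the kernels -/

/-- The integral of `g` against the kernel `Δ^j (t^{-N} S_j(|x - x₀|² / t²))`. -/
def average (x₀ : Eu N) (ρ : ℝ) (g : L2 Ω) (j : ℕ) (t : ℝ) : ℝ :=
  ∫ x in Ω, g x * kernel x₀ ρ j t x

theorem isFiniteMeasure_restrict (hb : Bornology.IsBounded Ω) :
    IsFiniteMeasure (volume.restrict Ω : Measure (Eu N)) :=
  ⟨by simpa using hb.measure_lt_top⟩

theorem integrable_of_bounded (hb : Bornology.IsBounded Ω) (g : L2 Ω) :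
    Integrable g (volume.restrict Ω) := by
  have := isFiniteMeasure_restrict hb
  exact (Lp.memLp g).integrable one_le_two

theorem integrable_mul_kernel (hb : Bornology.IsBounded Ω) (x₀ : Eu N) {ρ : ℝ} (hρ : 0 < ρ)
    (g : L2 Ω) (j : ℕ) {t : ℝ} (ht : 0 < t) :
    Integrable (fun x => g x * kernel x₀ ρ j t x) (volume.restrict Ω) := by
  obtain ⟨M, -, hM⟩ := exists_abs_kernel_le x₀ hρ j
  exact (integrable_of_bounded hb g).mul_bdd
    (continuous_kernel x₀ ρ j t).aestronglyMeasurable (Eventually.of_forall (hM t ht))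

theorem hasDerivAt_average (hb : Bornology.IsBounded Ω) (x₀ : Eu N) {ρ : ℝ} (hρ : 0 < ρ)
    (g : L2 Ω) (j : ℕ) {t : ℝ} (ht : 0 < t) :
    HasDerivAt (average x₀ ρ g j) (t * average x₀ ρ g (j + 1) t) t := by
  obtain ⟨M, hM0, hM⟩ := exists_abs_kernel_le x₀ hρ (j + 1)
  -- Staying away from `t = 0` makes the kernel bound uniform, as required for differentiating under
  -- the integral.
  have hs : Ioo (t / 2) (2 * t) ∈ 𝓝 t := Ioo_mem_nhds (by linarith) (by linarith)
  have key := (hasDerivAt_integral_of_dominated_loc_of_deriv_le (μ := volume.restrict Ω)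
    (F := fun t x => g x * kernel x₀ ρ j t x)
    (F' := fun t x => g x * (t * kernel x₀ ρ (j + 1) t x))
    (bound := fun x => |g x| * (2 * t * (((t / 2) ^ (N + 2 * (j + 1)))⁻¹ * M))) hs
    (Eventually.of_forall fun s => (Lp.aestronglyMeasurable g).mul
      (continuous_kernel x₀ ρ j s).aestronglyMeasurable)
    (integrable_mul_kernel hb x₀ hρ g j ht)
    ((Lp.aestronglyMeasurable g).mul
      (continuous_const.mul (continuous_kernel x₀ ρ (j + 1) t)).aestronglyMeasurable)
    (Eventually.of_forall fun x s hs => ?_)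
    ((integrable_of_bounded hb g).abs.mul_const _)
    (Eventually.of_forall fun x s hs => ?_)).2
  · refine key.congr_deriv ?_
    rw [average, ← integral_const_mul]
    refine integral_congr_ae (Eventually.of_forall fun x => ?_)
    simp only
    ring
  · have hs0 : 0 < s := by linarith [hs.1]
    rw [Real.norm_eq_abs, abs_mul, abs_mul, abs_of_pos hs0]
    gcongr
    · exact hs.2.le
    · refine (hM s hs0 x).trans ?_
      gcongr
      exact hs.1.le
  · have hs0 : 0 < s := by linarith [hs.1]
    exact (hasDerivAt_kernel x₀ ρ j hs0 x).const_mul _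

theorem average_add (hb : Bornology.IsBounded Ω) (x₀ : Eu N) {ρ : ℝ} (hρ : 0 < ρ)
    (g h : L2 Ω) (j : ℕ) {t : ℝ} (ht : 0 < t) :
    average x₀ ρ (g + h) j t = average x₀ ρ g j t + average x₀ ρ h j t := by
  rw [average, average, average, ← integral_add (integrable_mul_kernel hb x₀ hρ g j ht)
    (integrable_mul_kernel hb x₀ hρ h j ht)]
  refine integral_congr_ae ?_
  filter_upwards [Lp.coeFn_add g h] with x hx
  rw [hx, Pi.add_apply, add_mul]

theorem sq_integral_mul_le {φ : Eu N → ℝ} (hφ : MemLp φ 2 (volume.restrict Ω)) (g : L2 Ω) :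
    (∫ x in Ω, g x * φ x) ^ 2 ≤ ‖g‖ ^ 2 * ∫ x in Ω, φ x ^ 2 := by
  have h1 : ∫ x in Ω, g x * φ x = inner ℝ (hφ.toLp φ) g := by
    rw [MeasureTheory.L2.inner_def]
    refine integral_congr_ae ?_
    filter_upwards [hφ.coeFn_toLp] with x hx
    simp [hx]
  have h2 : ∫ x in Ω, φ x ^ 2 = ‖hφ.toLp φ‖ ^ 2 := by
    rw [← integral_sq_eq_norm_sq]
    refine integral_congr_ae ?_
    filter_upwards [hφ.coeFn_toLp] with x hx
    rw [hx]
  rw [h1, h2, ← mul_pow, ← sq_abs, mul_comm]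
  gcongr
  exact abs_real_inner_le_norm _ _

/-- Iterated integration of the relations `A_j' = t A_{j+1}`, in the variable `t = τ^p`. -/
theorem abs_le_of_hasDerivAt_chain {A : ℕ → ℝ → ℝ}
    (hA : ∀ j, ∀ t > 0, HasDerivAt (A j) (t * A (j + 1) t) t) {p J : ℕ} (hp : 1 ≤ p) {M : ℝ}
    (hM : 0 ≤ M) (h1 : ∀ j < J, |A j 1| ≤ M)
    (htop : ∀ τ ∈ Ioc (0 : ℝ) 1, |A J (τ ^ p)| * τ ^ (J * (2 * p - 1)) ≤ M) {τ : ℝ}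
    (hτ : τ ∈ Ioc (0 : ℝ) 1) : |A 0 (τ ^ p)| ≤ (1 + p) ^ J * M := by
  -- Descending induction from `J`. As `t dt = p τ^{2p-1} dτ`, each integration consumes exactly one
  -- factor `τ^{2p-1}` of the weight, and at `j = 0` the weight is gone. The substitution `t = τ^p`
  -- avoids fractional exponents and spreads the surplus half power of `t` over the `J` steps.
  have key : ∀ i j, j + i = J → ∀ τ ∈ Ioc (0 : ℝ) 1,
      |A j (τ ^ p)| * τ ^ (j * (2 * p - 1)) ≤ (1 + p) ^ i * M := by
    intro i
    induction i with
    | zero =>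
      rintro j rfl τ hτ
      simpa using htop τ hτ
    | succ i ih =>
      intro j hj τ hτ
      set C : ℝ := (1 + p) ^ i * M with hC
      have hC0 : 0 ≤ C := by positivity
      have hMC : M ≤ C := le_mul_of_one_le_left hM (one_le_pow₀ (by simp))
      have hB : ∀ s > 0, HasDerivAt (fun s => A j (s ^ p))
          (s ^ p * A (j + 1) (s ^ p) * (p * s ^ (p - 1))) s := fun s hs =>
        (hA j (s ^ p) (by positivity)).comp s (hasDerivAt_pow p s)
      have hbd : ∀ s ∈ Ico τ 1, ‖s ^ p * A (j + 1) (s ^ p) * (p * s ^ (p - 1))‖ ≤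
          p * C * (τ ^ (j * (2 * p - 1)))⁻¹ := by
        intro s hs
        have hs0 : 0 < s := hτ.1.trans_le hs.1
        have h2 := ih (j + 1) (by omega) s ⟨hs0, hs.2.le⟩
        have e1 : s ^ ((j + 1) * (2 * p - 1)) = s ^ (j * (2 * p - 1)) * (s ^ p * s ^ (p - 1)) := by
          rw [← pow_add, ← pow_add]
          congr 1
          rw [Nat.add_mul, one_mul]
          omega
        rw [e1] at h2
        have h3 : ‖s ^ p * A (j + 1) (s ^ p) * (p * s ^ (p - 1))‖ =
            p * (|A (j + 1) (s ^ p)| * (s ^ p * s ^ (p - 1))) := by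
          rw [norm_mul, norm_mul, norm_mul, Real.norm_of_nonneg (by positivity : 0 ≤ s ^ p),
            Real.norm_of_nonneg (by positivity : 0 ≤ s ^ (p - 1)), Real.norm_eq_abs,
            Real.norm_of_nonneg (by positivity : (0 : ℝ) ≤ p)]
          ring
        rw [h3, mul_assoc]
        refine mul_le_mul_of_nonneg_left ?_ (Nat.cast_nonneg p)
        have hpow : 0 < τ ^ (j * (2 * p - 1)) := pow_pos hτ.1 _
        rw [← div_eq_mul_inv, le_div_iff₀ hpow]
        refine le_trans ?_ h2
        have hle : τ ^ (j * (2 * p - 1)) ≤ s ^ (j * (2 * p - 1)) :=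
          pow_le_pow_left₀ hτ.1.le hs.1 _
        have hnn : 0 ≤ |A (j + 1) (s ^ p)| * (s ^ p * s ^ (p - 1)) := by positivity
        calc _ ≤ |A (j + 1) (s ^ p)| * (s ^ p * s ^ (p - 1)) * s ^ (j * (2 * p - 1)) := by gcongr
          _ = _ := by ring
      -- The derivative is bounded on all of `[τ, 1)` by its bound at `τ`, so the mean value
      -- inequality replaces an integration.
      have hmv := norm_image_sub_le_of_norm_deriv_le_segment'
        (fun s hs => (hB s (hτ.1.trans_le hs.1)).hasDerivWithinAt) hbd 1
        (right_mem_Icc.2 hτ.2)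
      simp only [one_pow, Real.norm_eq_abs] at hmv
      have hpow : 0 < τ ^ (j * (2 * p - 1)) := pow_pos hτ.1 _
      have hpow1 : τ ^ (j * (2 * p - 1)) ≤ 1 := pow_le_one₀ hτ.1.le hτ.2
      have h4 : |A j (τ ^ p)| ≤ M + p * C * (τ ^ (j * (2 * p - 1)))⁻¹ := by
        have h5 : p * C * (τ ^ (j * (2 * p - 1)))⁻¹ * (1 - τ) ≤
            p * C * (τ ^ (j * (2 * p - 1)))⁻¹ :=
          mul_le_of_le_one_right (by positivity) (by linarith [hτ.1])
        have h6 := h1 j (by omega)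
        have h7 := abs_sub_abs_le_abs_sub (A j (τ ^ p)) (A j 1)
        rw [abs_sub_comm] at h7
        linarith
      calc |A j (τ ^ p)| * τ ^ (j * (2 * p - 1))
          ≤ (M + p * C * (τ ^ (j * (2 * p - 1)))⁻¹) * τ ^ (j * (2 * p - 1)) := by gcongr
        _ = M * τ ^ (j * (2 * p - 1)) + p * C := by field_simp
        _ ≤ C + p * C := by
            gcongr
            exact (mul_le_of_le_one_right hM hpow1).trans hMC
        _ = (1 + p) ^ (i + 1) * M := by
            rw [hC]
            ring
  simpa using key J 0 (by omega) τ hτ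

/-! ### The kernels of highest order -/

theorem bump_eq_zero (x₀ : Eu N) {r : ℝ} (hr : 0 < r) (j : ℕ) {t : ℝ} (ht : 0 < t) {x : Eu N}
    (hx : r * t ≤ ‖x - x₀‖) : bump x₀ (r ^ 2) j t x = 0 := by
  rw [bump, radial, profile_eq_zero (by positivity), mul_zero]
  rw [← div_eq_inv_mul, le_div_iff₀ (by positivity), ← mul_pow]
  gcongr

theorem isTestFunction_bump {x₀ : Eu N} {r : ℝ} (hr : 0 < r) (hrΩ : Metric.closedBall x₀ r ⊆ Ω)
    (j : ℕ) {t : ℝ} (ht : t ∈ Ioc (0 : ℝ) 1) : IsTestFunction Ω (bump x₀ (r ^ 2) j t) := by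
  have hts : tsupport (bump x₀ (r ^ 2) j t) ⊆ Metric.closedBall x₀ r := by
    refine closure_minimal (fun x hx => ?_) Metric.isClosed_closedBall
    rw [Metric.mem_closedBall, dist_eq_norm]
    by_contra! h
    exact hx (bump_eq_zero x₀ hr j ht.1
      ((mul_le_of_le_one_right hr.le ht.2).trans h.le))
  exact ⟨contDiff_const.mul (contDiff_radial x₀ _ (contDiff_profile _ j)),
    (isCompact_closedBall x₀ r).of_isClosed_subset (isClosed_tsupport _) hts, hts.trans hrΩ⟩

theorem bump_eq_rescale (x₀ : Eu N) (ρ : ℝ) (j : ℕ) (t : ℝ) :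
    bump x₀ ρ j t = fun x => (t ^ N)⁻¹ * rescale x₀ t⁻¹ (bump 0 ρ j 1) x := by
  funext x
  simp [bump, rescale, radial, norm_smul, mul_pow]

theorem integral_bump_sq (x₀ : Eu N) (ρ : ℝ) (j : ℕ) {t : ℝ} (ht : 0 < t) :
    ∫ x, bump x₀ ρ j t x ^ 2 = (t ^ N)⁻¹ * ∫ x : Eu N, bump 0 ρ j 1 x ^ 2 := by
  have e : ∀ x, bump x₀ ρ j t x ^ 2 =
      ((t ^ N)⁻¹) ^ 2 * rescale x₀ t⁻¹ (fun x => bump 0 ρ j 1 x ^ 2) x := fun x => by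
    rw [bump_eq_rescale, mul_pow]
    rfl
  simp only [e]
  rw [integral_const_mul, integral_rescale x₀ (inv_pos.2 ht), ← mul_assoc, inv_pow t, inv_inv]
  congr 1
  field_simp

theorem integral_partialD_bump_sq (x₀ : Eu N) (ρ : ℝ) (j : ℕ) (i : Fin N) {t : ℝ} (ht : 0 < t) :
    ∫ x, partialD i (bump x₀ ρ j t) x ^ 2 =
      (t ^ (N + 2))⁻¹ * ∫ x : Eu N, partialD i (bump 0 ρ j 1) x ^ 2 := by
  have e : ∀ x, partialD i (bump x₀ ρ j t) x ^ 2 = ((t ^ N)⁻¹ * t⁻¹) ^ 2 *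
      rescale x₀ t⁻¹ (fun x => partialD i (bump 0 ρ j 1) x ^ 2) x := fun x => by
    rw [bump_eq_rescale, partialD_const_mul, partialD_rescale]
    simp only [rescale]
    ring
  simp only [e]
  rw [integral_const_mul, integral_rescale x₀ (inv_pos.2 ht), ← mul_assoc, inv_pow t, inv_inv]
  congr 1
  rw [pow_add]
  field_simp

theorem setIntegral_sq_le {D : Set (Eu N)} {φ : Eu N → ℝ} (hφ : IsTestFunction D φ) :
    ∫ x in Ω, φ x ^ 2 ≤ ∫ x, φ x ^ 2 :=
  setIntegral_le_integral (hφ.integrable_sq volume) (Eventually.of_forall fun _ => sq_nonneg _)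

theorem partialD_lapl_comm {D : Set (Eu N)} {φ : Eu N → ℝ} (hφ : IsTestFunction D φ) (i : Fin N) :
    partialD i (lapl φ) = lapl (partialD i φ) := by
  have comm : ∀ {ψ : Eu N → ℝ}, IsTestFunction D ψ → ∀ k,
      partialD i (partialD k ψ) = partialD k (partialD i ψ) := fun hψ k =>
    funext fun x => partialD_comm_eqOn isOpen_univ (hψ.contDiffOn _ _) i k (mem_univ x)
  funext x
  unfold lapl
  rw [partialD_sum_eqOn isOpen_univ Finset.univ
    (fun k _ => ((hφ.partialD k).partialD k).contDiffOn 1 univ) i (mem_univ x)]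
  refine Finset.sum_congr rfl fun k _ => ?_
  rw [comm (hφ.partialD k), comm hφ]

theorem partialD_lapl_iterate_comm {D : Set (Eu N)} {φ : Eu N → ℝ} (hφ : IsTestFunction D φ)
    (i : Fin N) (k : ℕ) : partialD i (lapl^[k] φ) = lapl^[k] (partialD i φ) := by
  induction k with
  | zero => rfl
  | succ k ih =>
    rw [Function.iterate_succ_apply', partialD_lapl_comm (hφ.lapl_iterate k), ih,
      Function.iterate_succ_apply']

/-- The kernel is `Δ^{m/2}` of a test function, so the weak derivatives transfer all Laplacians to
`f`. -/
theorem average_eq (f : Sobolev N m Ω) {x₀ : Eu N} {r : ℝ} (hr : 0 < r)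
    (hrΩ : Metric.closedBall x₀ r ⊆ Ω) {t : ℝ} (ht : t ∈ Ioc (0 : ℝ) 1) :
    average x₀ (r ^ 2) (weakD f 0) (m / 2) t =
      ∫ x in Ω, lapPow f (m / 2) 0 x * bump x₀ (r ^ 2) (m / 2) t x := by
  rw [integral_lapPow_mul f (isTestFunction_bump hr hrΩ _ ht) _ _
    (by simpa using Nat.mul_div_le m 2), lapl_iterate_bump, multiD_zero]
  simp [average]

/-- The kernel now carries `m + 1` derivatives, one more than `f` admits; one gradient therefore
stays on the bump. -/
theorem average_eq_of_odd (f : Sobolev N m Ω) (hm : ¬ Even m) {x₀ : Eu N} {r : ℝ} (hr : 0 < r)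
    (hrΩ : Metric.closedBall x₀ r ⊆ Ω) {t : ℝ} (ht : t ∈ Ioc (0 : ℝ) 1) :
    average x₀ (r ^ 2) (weakD f 0) (m / 2 + 1) t =
      -∑ i, ∫ x in Ω, lapPow f (m / 2) (Pi.single i 1) x *
        partialD i (bump x₀ (r ^ 2) (m / 2 + 1) t) x := by
  set σ := bump x₀ (r ^ 2) (m / 2 + 1) t with hσ
  have hσt : IsTestFunction Ω σ := isTestFunction_bump hr hrΩ _ ht
  have h1 : ∀ i, ∫ x in Ω, lapPow f (m / 2) (Pi.single i 1) x * partialD i σ x =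
      -∫ x in Ω, weakD f 0 x * partialD i (lapl^[m / 2] (partialD i σ)) x := by
    intro i
    rw [integral_lapPow_mul f (hσt.partialD i) _ _
      (by simpa using two_mul_half_add_one_le hm)]
    have e : multiD (Pi.single i 1) (lapl^[m / 2] (partialD i σ)) =
        partialD i (lapl^[m / 2] (partialD i σ)) := funext fun x =>
      multiD_single_eqOn isOpen_univ i (((hσt.partialD i).lapl_iterate _).contDiffOn _ _)
        (mem_univ x)
    rw [e]
    simp
  simp only [h1, Finset.sum_neg_distrib, neg_neg]
  rw [← integral_finsetSum _ fun i _ =>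
    (((hσt.partialD i).lapl_iterate _).partialD i).integrable_mul _, average]
  refine integral_congr_ae (Eventually.of_forall fun x => ?_)
  simp only
  rw [← Finset.mul_sum, ← lapl_iterate_bump, Function.iterate_succ_apply']
  simp only [← partialD_lapl_iterate_comm hσt]
  rfl

/-- By Cauchy-Schwarz the singularity of the square is `t^{-N}` for even `m`, and `t^{-(N+2)}` for
odd `m` because of the gradient on the bump. With `J = ⌈m/2⌉`, the assumption on `N` says in both
cases that the exponent is at most `4J - 1`. -/
theorem exists_average_sq_le (hN : N ≤ 2 * m - 1) (hm : 1 ≤ m) {x₀ : Eu N} {r : ℝ} (hr : 0 < r)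
    (hrΩ : Metric.closedBall x₀ r ⊆ Ω) :
    ∃ C, 0 ≤ C ∧ ∀ f : Sobolev N m Ω, ∀ t ∈ Ioc (0 : ℝ) 1,
      average x₀ (r ^ 2) (weakD f 0) ((m + 1) / 2) t ^ 2 * t ^ (4 * ((m + 1) / 2) - 1) ≤
        C * ∫ x in Ω, gradSq f x := by
  by_cases h : Even m
  · have hJ : (m + 1) / 2 = m / 2 := by
      obtain ⟨k, rfl⟩ := h
      omega
    refine ⟨∫ x : Eu N, bump 0 (r ^ 2) (m / 2) 1 x ^ 2, integral_nonneg fun x => sq_nonneg _,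
      fun f t ht => ?_⟩
    have hb := isTestFunction_bump hr hrΩ (m / 2) ht
    rw [hJ, average_eq f hr hrΩ ht, integral_gradSq, if_pos h]
    have h1 := (sq_integral_mul_le (hb.memLp _) (lapPow f (m / 2) 0)).trans
      (mul_le_mul_of_nonneg_left (setIntegral_sq_le hb) (sq_nonneg _))
    rw [integral_bump_sq _ _ _ ht.1] at h1
    have htN : t ^ (4 * (m / 2) - 1) ≤ t ^ N := by
      refine pow_le_pow_of_le_one ht.1.le ht.2 ?_
      obtain ⟨k, rfl⟩ := h
      omega
    have ht0 : 0 < t ^ N := pow_pos ht.1 _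
    refine (mul_le_mul_of_nonneg_left htN (sq_nonneg _)).trans
      ((mul_le_mul_of_nonneg_right h1 ht0.le).trans_eq ?_)
    field_simp
  · have hJ : (m + 1) / 2 = m / 2 + 1 := by
      obtain ⟨k, rfl⟩ := Nat.not_even_iff_odd.1 h
      omega
    set c : Fin N → ℝ := fun i => ∫ x : Eu N, partialD i (bump 0 (r ^ 2) (m / 2 + 1) 1) x ^ 2
      with hc
    have hc0 : ∀ i, 0 ≤ c i := fun i => integral_nonneg fun x => sq_nonneg _
    refine ⟨N * ∑ i, c i, mul_nonneg (Nat.cast_nonneg _) (Finset.sum_nonneg fun i _ => hc0 i),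
      fun f t ht => ?_⟩
    have hb := isTestFunction_bump hr hrΩ (m / 2 + 1) ht
    rw [hJ, average_eq_of_odd f h hr hrΩ ht, integral_gradSq, if_neg h, neg_sq]
    have ht0 : 0 < t ^ (N + 2) := pow_pos ht.1 _
    have h1 : ∀ i, (∫ x in Ω, lapPow f (m / 2) (Pi.single i 1) x *
        partialD i (bump x₀ (r ^ 2) (m / 2 + 1) t) x) ^ 2 ≤
        ‖lapPow f (m / 2) (Pi.single i 1)‖ ^ 2 * ((t ^ (N + 2))⁻¹ * ∑ k, c k) := by
      intro i
      refine (sq_integral_mul_le ((hb.partialD i).memLp _) _).trans ?_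
      gcongr
      refine (setIntegral_sq_le (hb.partialD i)).trans ?_
      rw [integral_partialD_bump_sq _ _ _ _ ht.1]
      gcongr
      exact Finset.single_le_sum (f := c) (fun k _ => hc0 k) (Finset.mem_univ i)
    have h2 := (sq_sum_le_card_mul_sum_sq (s := (Finset.univ : Finset (Fin N)))
      (f := fun i => ∫ x in Ω, lapPow f (m / 2) (Pi.single i 1) x *
        partialD i (bump x₀ (r ^ 2) (m / 2 + 1) t) x)).trans
      (mul_le_mul_of_nonneg_left (Finset.sum_le_sum fun i _ => h1 i) (Nat.cast_nonneg _))
    rw [← Finset.sum_mul, Finset.card_univ, Fintype.card_fin] at h2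
    have htN : t ^ (4 * (m / 2 + 1) - 1) ≤ t ^ (N + 2) := by
      refine pow_le_pow_of_le_one ht.1.le ht.2 ?_
      obtain ⟨k, rfl⟩ := Nat.not_even_iff_odd.1 h
      omega
    refine (mul_le_mul_of_nonneg_left htN (sq_nonneg _)).trans
      ((mul_le_mul_of_nonneg_right h2 ht0.le).trans_eq ?_)
    field_simp

/-- The averages of `f` at `x₀` are controlled by the `L²`-norm and the energy of `f`. -/
theorem exists_average_zero_sq_le (hN : N ≤ 2 * m - 1) (hm : 1 ≤ m)
    (hb : Bornology.IsBounded Ω) {x₀ : Eu N} {r : ℝ} (hr : 0 < r)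
    (hrΩ : Metric.closedBall x₀ r ⊆ Ω) :
    ∃ C, 0 ≤ C ∧ ∀ f : Sobolev N m Ω, ∀ τ ∈ Ioc (0 : ℝ) 1,
      average x₀ (r ^ 2) (weakD f 0) 0 (τ ^ (2 * ((m + 1) / 2))) ^ 2 ≤
        C * (‖weakD f 0‖ ^ 2 + ∫ x in Ω, gradSq f x) := by
  obtain ⟨C₁, hC₁, htop⟩ := exists_average_sq_le hN hm hr hrΩ
  set J := (m + 1) / 2 with hJ
  have hJ1 : 1 ≤ J := by omega
  set p := 2 * J with hp
  have hkm : ∀ j, IsTestFunction Ω (kernel x₀ (r ^ 2) j 1) := fun j => by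
    rw [← lapl_iterate_bump]
    exact (isTestFunction_bump hr hrΩ j ⟨one_pos, le_rfl⟩).lapl_iterate j
  set d : ℕ → ℝ := fun j => ∫ x in Ω, kernel x₀ (r ^ 2) j 1 x ^ 2 with hd
  have hd0 : ∀ j, 0 ≤ d j := fun j => integral_nonneg fun x => sq_nonneg _
  -- One constant for the energy bound on `A_J` and for the initial values `A_j(1)`, `j < J`, which
  -- need only the `L²`-norm of `f`.
  set C₂ : ℝ := C₁ + ∑ j ∈ Finset.range J, d j with hC₂
  have hC₂0 : 0 ≤ C₂ := add_nonneg hC₁ (Finset.sum_nonneg fun j _ => hd0 j)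
  refine ⟨((1 + p) ^ J) ^ 2 * C₂, by positivity, fun f τ hτ => ?_⟩
  set Q : ℝ := ‖weakD f 0‖ ^ 2 + ∫ x in Ω, gradSq f x with hQ
  have hE := integral_gradSq_nonneg f
  have hQ0 : 0 ≤ Q := by positivity
  have hmain := abs_le_of_hasDerivAt_chain (A := average x₀ (r ^ 2) (weakD f 0))
    (fun j t ht => hasDerivAt_average hb x₀ (by positivity) _ j ht) (p := p) (J := J) (by omega)
    (Real.sqrt_nonneg (C₂ * Q)) (fun j hj => ?_) (fun s hs => ?_) hτ
  · rw [← sq_abs, mul_assoc, ← Real.sq_sqrt (mul_nonneg hC₂0 hQ0), ← mul_pow]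
    gcongr
  · refine Real.abs_le_sqrt ((sq_integral_mul_le ((hkm j).memLp _) _).trans ?_)
    rw [mul_comm]
    refine mul_le_mul ?_ (by rw [hQ]; linarith) (sq_nonneg _) hC₂0
    have := Finset.single_le_sum (f := d) (fun k _ => hd0 k) (Finset.mem_range.2 hj)
    rw [hC₂]
    linarith
  · have hs0 : 0 ≤ s := hs.1.le
    refine Real.le_sqrt_of_sq_le ?_
    rw [mul_pow, sq_abs, ← pow_mul]
    have h1 := htop f (s ^ p) ⟨pow_pos hs.1 _, pow_le_one₀ hs0 hs.2⟩
    -- The choice `p = 2J` is made for this identity: the square of the weight in the chain is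
    -- exactly `t ^ (4J - 1)` at `t = s ^ p`.
    have e : J * (2 * p - 1) * 2 = p * (4 * J - 1) := by
      rw [hp, show 2 * (2 * J) = 4 * J by ring]
      ring
    rw [e, pow_mul s p (4 * J - 1)]
    refine h1.trans ?_
    refine mul_le_mul ?_ (by rw [hQ]; linarith [sq_nonneg ‖weakD f 0‖]) hE hC₂0
    rw [hC₂]
    linarith [Finset.sum_nonneg fun j (_ : j ∈ Finset.range J) => hd0 j]

/-! ### Positive capacity -/

theorem kernel_zero_eq_bump (x₀ : Eu N) (ρ : ℝ) (t : ℝ) : kernel x₀ ρ 0 t = bump x₀ ρ 0 t :=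
  (lapl_iterate_bump x₀ ρ 0 t).symm

theorem integral_bump (x₀ : Eu N) (ρ : ℝ) (j : ℕ) {t : ℝ} (ht : 0 < t) :
    ∫ x, bump x₀ ρ j t x = ∫ x : Eu N, bump 0 ρ j 1 x := by
  rw [bump_eq_rescale, integral_const_mul, integral_rescale x₀ (inv_pos.2 ht), ← mul_assoc]
  rw [inv_pow, inv_inv, inv_mul_cancel₀ (by positivity), one_mul]

theorem integral_bump_pos {r : ℝ} (hr : 0 < r) : 0 < ∫ x : Eu N, bump 0 (r ^ 2) 0 1 x := by
  have hb : IsTestFunction univ (bump (0 : Eu N) (r ^ 2) 0 1) :=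
    isTestFunction_bump hr (subset_univ _) 0 ⟨one_pos, le_rfl⟩
  refine hb.contDiff.continuous.integral_pos_of_hasCompactSupport_nonneg_nonzero
    hb.hasCompactSupport (fun x => ?_) (x := 0) ?_
  · simpa [bump, radial, profile] using Real.smoothTransition.nonneg _
  · simp [bump, radial, profile]

/-- If `f` is represented by a function equal to `c` near `x₀`, then so are its averages, up to
the normalization. -/
theorem eventually_average_eq {x₀ : Eu N} {r : ℝ} (hr : 0 < r)
    (hrΩ : Metric.closedBall x₀ r ⊆ Ω) {u : Eu N → ℝ} {c : ℝ} (hu : ∀ᶠ x in 𝓝 x₀, u x = c)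
    {f : Sobolev N m Ω} (hf : Represents u f) {q : ℕ} (hq : q ≠ 0) :
    ∀ᶠ τ in 𝓝[>] (0 : ℝ), average x₀ (r ^ 2) (weakD f 0) 0 (τ ^ q) =
      c * ∫ x : Eu N, bump 0 (r ^ 2) 0 1 x := by
  obtain ⟨δ, hδ, hball⟩ := Metric.eventually_nhds_iff.1 hu
  have hlim : Tendsto (fun τ : ℝ => r * τ ^ q) (𝓝 0) (𝓝 0) := by
    have : Continuous fun τ : ℝ => r * τ ^ q := by fun_prop
    simpa [hq] using this.tendsto 0
  filter_upwards [(hlim.eventually (gt_mem_nhds hδ)).filter_mono nhdsWithin_le_nhds,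
    Ioc_mem_nhdsGT (zero_lt_one' ℝ)] with τ hτδ hτ
  have ht : τ ^ q ∈ Ioc (0 : ℝ) 1 := ⟨pow_pos hτ.1 _, pow_le_one₀ hτ.1.le hτ.2⟩
  have hb := isTestFunction_bump hr hrΩ 0 ht
  rw [← integral_bump x₀ _ 0 ht.1, ← integral_const_mul,
    ← setIntegral_eq_integral_of_forall_compl_eq_zero (s := Ω)
      (f := fun x => c * bump x₀ (r ^ 2) 0 (τ ^ q) x)
      fun x hx => by rw [hb.eq_zero hx, mul_zero], average, kernel_zero_eq_bump]
  refine integral_congr_ae ?_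
  filter_upwards [hf 0 (mem_multiIndices.2 (by simp))] with x hx
  rw [hx, multiD_zero]
  by_cases h : r * τ ^ q ≤ ‖x - x₀‖
  · rw [bump_eq_zero x₀ hr 0 ht.1 h, mul_zero, mul_zero]
  · rw [hball (by rw [dist_eq_norm]; linarith)]

/-- Approximate `g` by some `k` vanishing near `x₀`: the averages of `g - k` are small uniformly in
the radius, and those of `k` are zero at small radii, how small depending on `k`. -/
theorem eventually_abs_average_lt (hN : N ≤ 2 * m - 1) (hm : 1 ≤ m)
    (hb : Bornology.IsBounded Ω) {x₀ : Eu N} {r : ℝ} (hr : 0 < r)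
    (hrΩ : Metric.closedBall x₀ r ⊆ Ω) {bc : BoundaryCondition} {g : Sobolev N m Ω}
    (hg : g ∈ V₀ bc m Ω {x₀}) {δ : ℝ} (hδ : 0 < δ) :
    ∀ᶠ τ in 𝓝[>] (0 : ℝ),
      |average x₀ (r ^ 2) (weakD g 0) 0 (τ ^ (2 * ((m + 1) / 2)))| < δ := by
  obtain ⟨C, hC, hle⟩ := exists_average_zero_sq_le hN hm hb hr hrΩ
  have hcont : Continuous fun k : Sobolev N m Ω =>
      C * (‖weakD (g - k) 0‖ ^ 2 + ∫ x in Ω, gradSq (g - k) x) :=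
    continuous_const.mul ((((continuous_lapPow 0 0).norm.pow 2).add
      continuous_integral_gradSq).comp (continuous_const.sub continuous_id))
  have h0 : C * (‖weakD (g - g) 0‖ ^ 2 + ∫ x in Ω, gradSq (g - g) x) = 0 := by
    have e : ∀ (k : ℕ) (α : Fin N → ℕ), lapPow (0 : Sobolev N m Ω) k α = 0 := fun k α => by
      rw [← lapPowL_apply, map_zero]
    have e' : weakD (0 : Sobolev N m Ω) 0 = 0 := e 0 0
    rw [sub_self, integral_gradSq]
    simp [e, e']
  have hev : ∀ᶠ k in 𝓝 g,
      C * (‖weakD (g - k) 0‖ ^ 2 + ∫ x in Ω, gradSq (g - k) x) < δ ^ 2 :=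
    hcont.continuousAt.eventually_lt continuousAt_const (by rw [h0]; positivity)
  obtain ⟨k, ⟨u, hu, hk⟩, hkδ⟩ := ((mem_closure_iff_frequently.1 hg).and_eventually hev).exists
  have hq : 2 * ((m + 1) / 2) ≠ 0 := by omega
  filter_upwards [eventually_average_eq hr hrΩ hu.eventually_eq_zero hk hq,
    Ioc_mem_nhdsGT (zero_lt_one' ℝ)] with τ h1 hτ
  have e : weakD g 0 = weakD (g - k) 0 + weakD k 0 := by
    simp only [← weakDL_apply, map_sub, sub_add_cancel]
  rw [e, average_add hb x₀ (by positivity) _ _ 0 (pow_pos hτ.1 _), h1, zero_mul, add_zero]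
  exact abs_lt_of_sq_lt_sq ((hle (g - k) τ hτ).trans_lt hkδ) hδ.le

theorem capV_singleton_pos (hN1 : 1 ≤ N) (hN : N ≤ 2 * m - 1) (hm : 1 ≤ m) (hΩ : IsOpen Ω)
    (hb : Bornology.IsBounded Ω) {x₀ : Eu N} (hx₀ : x₀ ∈ Ω) {η : Eu N → ℝ}
    (hη : IsCutoff Ω {x₀} η) (bc : BoundaryCondition) : 0 < capV bc m Ω {x₀} η := by
  obtain ⟨r, hr, hrΩ⟩ := Metric.nhds_basis_closedBall.mem_iff.1 (hΩ.mem_nhds hx₀)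
  obtain ⟨C, hC, hle⟩ := exists_average_zero_sq_le hN hm hb hr hrΩ
  obtain ⟨C', hC', hle'⟩ := exists_norm_sq_le_integral_gradSq hN1 hΩ hb bc m
  have hc := integral_bump_pos (N := N) hr
  set c := ∫ x : Eu N, bump 0 (r ^ 2) 0 1 x with hcdef
  have hη1 := hη.2
  rw [nhdsSet_singleton] at hη1
  have hq : 2 * ((m + 1) / 2) ≠ 0 := by omega
  -- `C` bounds the averages and `C'` absorbs the `L²`-norm into the energy; the summand `1` only
  -- keeps the divisor positive.
  set K : ℝ := C * (C' + 1) + 1 with hK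
  have hK0 : 0 < K := by positivity
  have hlow : ∀ f h : Sobolev N m Ω, f ∈ V bc m Ω → Represents η h → f - h ∈ V₀ bc m Ω {x₀} →
      (c / 2) ^ 2 / K ≤ ∫ x in Ω, gradSq f x := by
    intro f h hf hh hfh
    obtain ⟨τ, h1, h2, hτ⟩ := ((eventually_average_eq hr hrΩ hη1 hh hq).and
      ((eventually_abs_average_lt hN hm hb hr hrΩ hfh (half_pos hc)).and
        (Ioc_mem_nhdsGT (zero_lt_one' ℝ)))).exists
    have e : weakD f 0 = weakD (f - h) 0 + weakD h 0 := by
      simp only [← weakDL_apply, map_sub, sub_add_cancel]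
    have h3 := hle f τ hτ
    rw [e, average_add hb x₀ (by positivity) _ _ 0 (pow_pos hτ.1 _), h1, one_mul, ← e] at h3
    have h4 := hle' f hf
    have hE := integral_gradSq_nonneg f
    rw [div_le_iff₀ hK0]
    -- The averages of `η` equal `c` at this radius and those of `f - η` are below `c / 2` in
    -- absolute value.
    have h5 : (c / 2) ^ 2 ≤
        (average x₀ (r ^ 2) (weakD (f - h) 0) 0 (τ ^ (2 * ((m + 1) / 2))) + c) ^ 2 := by
      have := (abs_lt.1 h2).1
      gcongr
      linarith
    refine h5.trans (h3.trans ?_)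
    calc C * (‖weakD f 0‖ ^ 2 + ∫ x in Ω, gradSq f x)
        ≤ C * (C' * (∫ x in Ω, gradSq f x) + ∫ x in Ω, gradSq f x) := by gcongr
      _ ≤ (∫ x in Ω, gradSq f x) * K := by
          rw [hK]
          linarith
  have hpos : 0 < (c / 2) ^ 2 / K := by positivity
  refine hpos.trans_le (le_csInf ?_ ?_)
  -- Nonemptiness is essential, since the real infimum of the empty set is `0`; `η` itself is
  -- admissible.
  · obtain ⟨h, hh⟩ := exists_represents (m := m) hη.1
    refine ⟨_, h, h, subset_closure ⟨η, hη.1.isX hΩ bc, hh⟩, hh, ?_, rfl⟩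
    refine subset_closure ⟨fun x => η x - η x, ?_,
      hh.sub hΩ (hη.1.contDiffOn _ _) (hη.1.contDiffOn _ _) hh⟩
    have e : (fun x => η x - η x) = fun x => 0 * η x := by
      funext x
      ring
    rw [e]
    exact (hη.1.const_mul 0).isX₀ hΩ (Eventually.of_forall fun x => zero_mul _) bc
  · rintro a ⟨f, h, hf, hh, hfh, rfl⟩
    exact hlow f h hf hh hfh

end HigherCapacity

end

theorem mainTheorem10 {N m : ℕ} (hN : 1 ≤ N) (hm : 1 ≤ m)
    (bc : HigherCapacity.BoundaryCondition)
    {Ω : Set (HigherCapacity.Eu N)} (hΩ : HigherCapacity.IsBoundedSmoothDomain Ω)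
    {x₀ : HigherCapacity.Eu N} (hx₀ : x₀ ∈ Ω)
    {η : HigherCapacity.Eu N → ℝ} (hη : HigherCapacity.IsCutoff Ω {x₀} η) :
    (2 * m ≤ N → HigherCapacity.capV bc m Ω {x₀} η = 0) ∧
      (N ≤ 2 * m - 1 → 0 < HigherCapacity.capV bc m Ω {x₀} η) :=
  ⟨fun h => HigherCapacity.capV_singleton_eq_zero hΩ.isOpen hx₀ hη bc hm h,
    fun h => HigherCapacity.capV_singleton_pos hN h hm hΩ.isOpen hΩ.isBounded hx₀ hη bc⟩
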